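/- Let $A$ be a symmetric $v\times v$ matrix with integer entries, even diagonal entries and positive eigenvalues, and let $Q(\mathbf{x}) = {}^t\mathbf{x}A\mathbf{x}$ be the associated even positive-definite quadratic form in $v$ variables. The level of $Q$ is the smallest positive integer $N$ such that $NA^{-1}$ has integer entries and even diagonal entries. Suppose that $Q$ has level two. (1) If $8 \mid v$, then $Q$ represents a positive even integer $2n \le 2 + \frac{v}{4}$, i.e. there are a positive integer $n$ with $2n \le 2+\frac v4$ and a vector $\mathbf{x}\in\mathbf{Z}^v$ with $Q(\mathbf{x}) = 2n$. (2) If $v \equiv 4 \pmod 8$, then $Q$ represents a positive even integer $2n \le 1 + \frac{v}{4}$. -/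

import Mathlib

/-- A rational square matrix with integer entries and even integers on the diagonal. -/
def IsEvenIntegral {v : ℕ} (B : Matrix (Fin v) (Fin v) ℚ) : Prop :=
  (∀ i j, ∃ k : ℤ, B i j = k) ∧ ∀ i, ∃ k : ℤ, B i i = 2 * k

/-- The matrices `A` of even positive-definite quadratic forms: symmetric, integer entries,
even diagonal entries, and positive definite over the reals. -/
structure IsEvenPosDef {v : ℕ} (A : Matrix (Fin v) (Fin v) ℤ) : Prop where
  isSymm : A.IsSymm
  even_diag : ∀ i, Even (A i i)
  posDef : (A.map (Int.cast : ℤ → ℝ)).PosDef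

/-- `Q_A` has level `N`: `N` is the smallest positive integer such that `N A⁻¹` has integer entries
and even diagonal entries. -/
def HasLevel {v : ℕ} (A : Matrix (Fin v) (Fin v) ℤ) (N : ℕ) : Prop :=
  IsLeast {M : ℕ | 0 < M ∧ IsEvenIntegral ((M : ℚ) • (A.map (Int.cast : ℤ → ℚ))⁻¹)} N

/-- The quadratic form `Q_A(x) = ᵗx A x` on `ℤ^v`. -/
def quadForm {v : ℕ} (A : Matrix (Fin v) (Fin v) ℤ) : QuadraticForm ℤ (Fin v → ℤ) :=
  A.toQuadraticForm'

theorem quadForm_apply {v : ℕ} (A : Matrix (Fin v) (Fin v) ℤ) (x : Fin v → ℤ) :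
    quadForm A x = x ⬝ᵥ A.mulVec x := by
  simp [quadForm, Matrix.toQuadraticForm', Matrix.toLinearMap₂'_apply']

/-- An integral quadratic form represents `m` if it takes the value `m` at an integer vector. -/
def Represents {v : ℕ} (Q : QuadraticForm ℤ (Fin v → ℤ)) (m : ℤ) : Prop :=
  ∃ x : Fin v → ℤ, Q x = m

/-! Put `q = exp(2πiτ)` and let `Θ = ∑ q^(Q(x)/2)`. Since `2A⁻¹` is again even, Poisson summation
shows that `τ ↦ -1/τ` carries `Θ` to a theta series in `exp(πiτ)`, with weight `v/2`. Let `v = 8k`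
(with `k > 0`) or `v = 8k + 4`. If `Q` took none of the values `2, …, 2(k+1)`, then `Θ = 1 +
O(q^(k+2))`. Multiply `Θ` by a form `G` of weight `2 - v/2` for `Γ₀(2)`, holomorphic on the upper
half-plane, with a pole of order `k + 1` at infinity, and such that `ΘG` vanishes at the cusp `0`.
The differential `ΘG dτ` has no pole except at infinity, so its residue there is zero
(`coeff_eq_zero_of_inversion`). But this residue is, up to a scalar, the constant term of `G`, and a
contradiction follows once that is nonzero.

Let `a = η(τ)¹⁶/η(2τ)⁸` and `b = η(2τ)¹⁶/η(τ)⁸ = q + …`, of weight 4 and exchanged by the inversion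
up to scaling. For `v = 8k + 4` take `G = a b^(-k-1)`. For `v = 8k` take `G = a⁻ᵏ · q d/dq
(a/b)^(k+1)`; integrating by parts, its constant term is `k` times that of `b^(-k-1) · q da/dq`.

Both constant terms are nonzero by positivity after `q ↦ -q`. In the first case `G` becomes, up to
sign and a power of `q`, a product of factors `1 + q^(2n-1)` and `(1 - q^(2n))⁻¹`. In the second,
Gauss's identity gives `a(-q) = (∑ q^(n²))⁸`, whose derivative has nonnegative coefficients. -/

section DiscExpansion

/-! ### Power series expansions on the unit disc. -/

open Complex Filter Topology PowerSeries

/-- `p` is the power series expansion of `f` on the open unit disc. -/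
def HasDiscExpansion (f : ℂ → ℂ) (p : ℂ⟦X⟧) : Prop :=
  ∀ q : ℂ, ‖q‖ < 1 → HasSum (fun n ↦ coeff n p * q ^ n) (f q)

namespace HasDiscExpansion

variable {f g : ℂ → ℂ} {p r : ℂ⟦X⟧}

lemma congr (hf : HasDiscExpansion f p) (h : ∀ q : ℂ, ‖q‖ < 1 → g q = f q) :
    HasDiscExpansion g p := fun q hq ↦ by
  rw [h q hq]; exact hf q hq

lemma hasFPowerSeriesOnBall (hf : HasDiscExpansion f p) :
    HasFPowerSeriesOnBall f (FormalMultilinearSeries.ofScalars ℂ (fun n ↦ coeff n p)) 0 1 where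
  r_le := by
    refine ENNReal.le_of_forall_nnreal_lt fun r hr ↦ ?_
    refine FormalMultilinearSeries.le_radius_of_summable _ ?_
    have h := (hf (r : ℂ) (by simpa using hr)).summable.norm
    simpa [FormalMultilinearSeries.ofScalars_norm] using h
  r_pos := one_pos
  hasSum := by
    intro y hy
    have : ‖y‖ < 1 := by simpa [← ofReal_norm, ← ENNReal.ofReal_one] using hy
    simpa [FormalMultilinearSeries.ofScalars_apply_eq, mul_comm] using hf y this

lemma differentiableOn (hf : HasDiscExpansion f p) :
    DifferentiableOn ℂ f (Metric.ball 0 1) := by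
  have := hf.hasFPowerSeriesOnBall.differentiableOn
  rwa [← ENNReal.ofReal_one, Metric.eball_ofReal] at this

lemma unique (hf : HasDiscExpansion f p) (hg : HasDiscExpansion f r) : p = r := by
  have h := hf.hasFPowerSeriesOnBall.hasFPowerSeriesAt.eq_formalMultilinearSeries
    hg.hasFPowerSeriesOnBall.hasFPowerSeriesAt
  ext n
  have := congrArg (fun s ↦ s.coeff n) h
  simpa [FormalMultilinearSeries.coeff_ofScalars] using this

lemma of_differentiableOn (hf : DifferentiableOn ℂ f (Metric.ball 0 1)) :
    HasDiscExpansion f (PowerSeries.mk fun n ↦ iteratedDeriv n f 0 / n.factorial) := fun q hq ↦ by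
  have := hasSum_taylorSeries_on_ball hf (z := q) (by simpa using hq)
  convert! this using 2 with n
  simp only [coeff_mk, sub_zero, smul_eq_mul]
  ring

lemma coeff_zero (hf : HasDiscExpansion f p) : coeff 0 p = f 0 := by
  refine (hasSum_single 0 fun n hn ↦ ?_).unique (hf 0 (by simp)) |>.symm ▸ ?_ <;> simp [*]

protected lemma one : HasDiscExpansion (fun _ ↦ 1) 1 := fun q _ ↦ by
  convert hasSum_single (f := fun n ↦ coeff n (1 : ℂ⟦X⟧) * q ^ n) 0 fun n hn ↦ ?_ using 1 <;>
    simp [PowerSeries.coeff_one, *]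

protected lemma X : HasDiscExpansion (fun q ↦ q) X := fun q _ ↦ by
  convert hasSum_single (f := fun n ↦ coeff n (X : ℂ⟦X⟧) * q ^ n) 1 fun n hn ↦ ?_ using 1 <;>
    simp [PowerSeries.coeff_X, *]

lemma add (hf : HasDiscExpansion f p) (hg : HasDiscExpansion g r) :
    HasDiscExpansion (fun q ↦ f q + g q) (p + r) := fun q hq ↦ by
  simpa [add_mul] using (hf q hq).add (hg q hq)

lemma mul (hf : HasDiscExpansion f p) (hg : HasDiscExpansion g r) :
    HasDiscExpansion (fun q ↦ f q * g q) (p * r) := fun q hq ↦ by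
  have h := hasSum_sum_range_mul_of_summable_norm (hf q hq).summable.norm (hg q hq).summable.norm
  rw [(hf q hq).tsum_eq, (hg q hq).tsum_eq] at h
  convert! h using 2 with n
  rw [PowerSeries.coeff_mul, Finset.Nat.sum_antidiagonal_eq_sum_range_succ_mk, Finset.sum_mul]
  refine Finset.sum_congr rfl fun k hk ↦ ?_
  have : q ^ n = q ^ k * q ^ (n - k) := by
    rw [← pow_add, Nat.add_sub_cancel' (by simpa [Nat.lt_succ_iff] using hk)]
  rw [this]; ring

lemma pow (hf : HasDiscExpansion f p) (n : ℕ) : HasDiscExpansion (fun q ↦ f q ^ n) (p ^ n) := by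
  induction n with
  | zero => simpa using HasDiscExpansion.one
  | succ n ih => simpa [pow_succ] using ih.mul hf

lemma mul_deriv (hf : HasDiscExpansion f p) :
    HasDiscExpansion (fun q ↦ q * deriv f q) (X * derivative ℂ p) := by
  have hp := hf.unique (of_differentiableOn hf.differentiableOn)
  have h := of_differentiableOn (hf.differentiableOn.deriv Metric.isOpen_ball)
  convert HasDiscExpansion.X.mul h using 2
  ext n
  rw [PowerSeries.coeff_derivative, hp, PowerSeries.coeff_mk, PowerSeries.coeff_mk,
    ← iteratedDeriv_succ', Nat.factorial_succ]
  push_cast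
  have : (n : ℂ) + 1 ≠ 0 := by exact_mod_cast n.succ_ne_zero
  field_simp

lemma comp_neg (hf : HasDiscExpansion f p) :
    HasDiscExpansion (fun q ↦ f (-q)) (rescale (-1) p) := fun q hq ↦ by
  convert hf (-q) (by simpa using hq) using 2 with n
  rw [coeff_rescale, neg_pow q]; ring

/-- Serves to integrate `q⁻ᵐ g`: it separates the principal part and the constant term from a part
with a primitive on the disc. -/
lemma remainder (hf : HasDiscExpansion f p) (m : ℕ) :
    ∃ R : ℂ → ℂ, HasDiscExpansion R (PowerSeries.mk fun n ↦ coeff (n + m) p) ∧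
      ∀ q : ℂ, ‖q‖ < 1 → f q = ∑ j ∈ Finset.range m, coeff j p * q ^ j + q ^ m * R q := by
  have hs (q : ℂ) (hq : ‖q‖ < 1) : Summable fun n ↦ coeff (n + m) p * q ^ n := by
    rcases eq_or_ne q 0 with rfl | h0
    · refine summable_of_ne_finset_zero (s := {0}) fun n hn ↦ ?_
      simp [show n ≠ 0 by simpa using hn]
    · refine ((((summable_nat_add_iff m).2 (hf q hq).summable)).mul_right (q ^ m)⁻¹).congr
        fun n ↦ ?_
      rw [pow_add]; field_simp
  refine ⟨fun q ↦ ∑' n, coeff (n + m) p * q ^ n, fun q hq ↦ ?_, fun q hq ↦ ?_⟩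
  · simpa using (hs q hq).hasSum
  · rw [← (hf q hq).tsum_eq, ← (hf q hq).summable.sum_add_tsum_nat_add m, ← tsum_mul_left]
    congr 2 with n
    rw [pow_add]; ring

end HasDiscExpansion

/-- For a power series `α` and `σ`, the `m`-th coefficient of `α (X σ' - m σ)` is minus that of
`σ X α'`, as the `m`-th coefficient of `X (α σ)' - m α σ` vanishes. -/
lemma coeff_mul_X_mul_derivative_sub (α σ : ℂ⟦X⟧) (m : ℕ) :
    coeff m (α * (X * derivative ℂ σ - (m : ℂ⟦X⟧) * σ)) = -coeff m (σ * (X * derivative ℂ α)) := by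
  have hX (s : ℂ⟦X⟧) : coeff m (X * derivative ℂ s) = m * coeff m s := by
    cases m with
    | zero => simp
    | succ m => rw [coeff_succ_X_mul, coeff_derivative]; push_cast; ring
  have h := hX (α * σ)
  have hm (s : ℂ⟦X⟧) : coeff m ((m : ℂ⟦X⟧) * s) = m * coeff m s := by
    rw [← nsmul_eq_mul, map_nsmul, nsmul_eq_mul]
  rw [Derivation.leibniz, smul_eq_mul, smul_eq_mul] at h
  rw [show α * (X * derivative ℂ σ - (m : ℂ⟦X⟧) * σ) =
    X * (α * derivative ℂ σ + σ * derivative ℂ α) - (m : ℂ⟦X⟧) * (α * σ)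
      - σ * (X * derivative ℂ α) by ring, map_sub, map_sub, h, hm]
  ring

/-! ### Power series with nonnegative coefficients. -/

open scoped ComplexOrder

/-- Functions on the open unit disc whose power series has nonnegative coefficients. -/
def HasNonnegExpansion (f : ℂ → ℂ) : Prop :=
  ∃ p : ℂ⟦X⟧, (∀ n, 0 ≤ coeff n p) ∧ HasDiscExpansion f p

lemma coeff_mul_nonneg {p r : ℂ⟦X⟧} (hp : ∀ n, 0 ≤ coeff n p) (hr : ∀ n, 0 ≤ coeff n r) (n : ℕ) :
    0 ≤ coeff n (p * r) := by
  rw [PowerSeries.coeff_mul]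
  exact Finset.sum_nonneg fun x _ ↦ mul_nonneg (hp _) (hr _)

lemma coeff_mul_coeff_le {p r : ℂ⟦X⟧} (hp : ∀ n, 0 ≤ coeff n p) (hr : ∀ n, 0 ≤ coeff n r)
    (i j : ℕ) : coeff i p * coeff j r ≤ coeff (i + j) (p * r) := by
  rw [PowerSeries.coeff_mul]
  exact Finset.single_le_sum (f := fun x : ℕ × ℕ ↦ coeff x.1 p * coeff x.2 r)
    (fun x _ ↦ mul_nonneg (hp _) (hr _)) (a := (i, j)) (by simp)

namespace HasNonnegExpansion

variable {f g : ℂ → ℂ}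

protected lemma one : HasNonnegExpansion (fun _ ↦ 1) :=
  ⟨1, fun n ↦ by rw [PowerSeries.coeff_one]; split_ifs <;> simp, .one⟩

lemma mul (hf : HasNonnegExpansion f) (hg : HasNonnegExpansion g) :
    HasNonnegExpansion (fun q ↦ f q * g q) := by
  obtain ⟨p, hp, hfp⟩ := hf
  obtain ⟨r, hr, hgr⟩ := hg
  exact ⟨p * r, coeff_mul_nonneg hp hr, hfp.mul hgr⟩

lemma pow (hf : HasNonnegExpansion f) (n : ℕ) : HasNonnegExpansion (fun q ↦ f q ^ n) := by
  induction n with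
  | zero => simpa using HasNonnegExpansion.one
  | succ n ih => simpa [pow_succ] using ih.mul hf

lemma prod {ι : Type*} (s : Finset ι) {F : ι → ℂ → ℂ} (h : ∀ i ∈ s, HasNonnegExpansion (F i)) :
    HasNonnegExpansion (fun q ↦ ∏ i ∈ s, F i q) := by
  classical
  induction s using Finset.induction_on with
  | empty => simpa using HasNonnegExpansion.one
  | insert a s ha ih =>
    simp only [Finset.prod_insert ha]
    exact (h a (by simp)).mul (ih fun i hi ↦ h i (by simp [hi]))

lemma add (hf : HasNonnegExpansion f) (hg : HasNonnegExpansion g) :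
    HasNonnegExpansion (fun q ↦ f q + g q) := by
  obtain ⟨p, hp, hfp⟩ := hf
  obtain ⟨r, hr, hgr⟩ := hg
  exact ⟨p + r, fun n ↦ by simpa using add_nonneg (hp n) (hr n), hfp.add hgr⟩

lemma sum {ι : Type*} (s : Finset ι) {F : ι → ℂ → ℂ} (h : ∀ i ∈ s, HasNonnegExpansion (F i)) :
    HasNonnegExpansion (fun q ↦ ∑ i ∈ s, F i q) := by
  classical
  induction s using Finset.induction_on with
  | empty => exact ⟨0, by simp, fun q _ ↦ by simp⟩
  | insert a s ha ih =>
    simp only [Finset.sum_insert ha]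
    exact (h a (by simp)).add (ih fun i hi ↦ h i (by simp [hi]))

protected lemma id : HasNonnegExpansion (fun q ↦ q) :=
  ⟨X, fun n ↦ by rw [PowerSeries.coeff_X]; split_ifs <;> simp, .X⟩

/-- Nonnegativity of the coefficients is preserved under pointwise limits on the disc. -/
lemma of_tendsto {F : ℕ → ℂ → ℂ} (hF : ∀ N, HasNonnegExpansion (F N))
    (h : ∀ q : ℂ, ‖q‖ < 1 → Tendsto (fun N ↦ F N q) atTop (𝓝 (f q))) :
    HasNonnegExpansion f := by
  choose p hp hFp using hF
  -- At a positive radius all terms are nonnegative, so each is at most `F N ρ`, which is bounded in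
  -- `N` because it converges.
  have key (ρ : ℝ) (h0 : 0 < ρ) (h1 : ρ < 1) :
      ∃ M : ℝ, ∀ N n, ‖coeff n (p N)‖ * ρ ^ n ≤ M := by
    have hρ : ‖(ρ : ℂ)‖ < 1 := by simpa [abs_of_pos h0] using h1
    obtain ⟨M, hM⟩ := (h ρ hρ).norm.bddAbove_range
    refine ⟨M, fun N n ↦ le_trans ?_ (hM ⟨N, rfl⟩)⟩
    have hle : coeff n (p N) * (ρ : ℂ) ^ n ≤ F N ρ :=
      le_hasSum (hFp N ρ hρ) n fun j _ ↦
        mul_nonneg (hp N j) (pow_nonneg (by exact_mod_cast h0.le) _)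
    have hnn : 0 ≤ coeff n (p N) * (ρ : ℂ) ^ n :=
      mul_nonneg (hp N n) (pow_nonneg (by exact_mod_cast h0.le) _)
    have := CStarAlgebra.norm_le_norm_of_nonneg_of_le hnn hle
    simpa [abs_of_pos h0] using this
  -- Bounded coefficients converge along an ultrafilter, and dominated convergence then identifies
  -- the limit series with `f`.
  let U : Ultrafilter ℕ := Ultrafilter.of atTop
  have hU : (U : Filter ℕ) ≤ atTop := Ultrafilter.of_le atTop
  have hlim (n : ℕ) : ∃ c : ℂ, Tendsto (fun N ↦ coeff n (p N)) U (𝓝 c) := by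
    obtain ⟨M, hM⟩ := key (1 / 2) (by norm_num) (by norm_num)
    have hc := isCompact_closedBall (0 : ℂ) (M / (1 / 2) ^ n)
    obtain ⟨c, -, hc⟩ := hc.ultrafilter_le_nhds (U.map fun N ↦ coeff n (p N)) (by
      rw [le_principal_iff, Ultrafilter.coe_map, Filter.mem_map]
      refine Filter.univ_mem' fun N ↦ ?_
      simpa only [Set.mem_preimage, mem_closedBall_zero_iff,
        le_div_iff₀ (show (0:ℝ) < (1 / 2) ^ n by positivity)] using hM N n)
    exact ⟨c, hc⟩
  choose c hc using hlim
  refine ⟨PowerSeries.mk c, fun n ↦ ?_, fun q hq ↦ ?_⟩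
  · rw [PowerSeries.coeff_mk]
    exact ge_of_tendsto' (hc n) fun N ↦ hp N n
  · obtain ⟨ρ, hρ, hρ1⟩ := exists_between hq
    have h0 : 0 < ρ := (norm_nonneg q).trans_lt hρ
    obtain ⟨M, hM⟩ := key ρ h0 hρ1
    have hb : Summable fun n ↦ M * (‖q‖ / ρ) ^ n :=
      (summable_geometric_of_lt_one (by positivity) ((div_lt_one h0).2 hρ)).mul_left M
    have hbound (N n : ℕ) : ‖coeff n (p N) * q ^ n‖ ≤ M * (‖q‖ / ρ) ^ n := by
      rw [norm_mul, norm_pow, div_pow, ← mul_div_assoc, le_div_iff₀ (by positivity), mul_right_comm]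
      exact mul_le_mul_of_nonneg_right (hM N n) (by positivity)
    have ht := tendsto_tsum_of_dominated_convergence (𝓕 := (U : Filter ℕ)) hb
      (fun n ↦ (hc n).mul_const (q ^ n)) (.of_forall hbound)
    simp only [(hFp _ q hq).tsum_eq] at ht
    have heq := tendsto_nhds_unique ht ((h q hq).mono_left hU)
    have hs : Summable fun n ↦ c n * q ^ n := hb.of_norm_bounded fun n ↦
      le_of_tendsto' ((hc n).mul_const (q ^ n)).norm fun N ↦ hbound N n
    simpa [← heq] using hs.hasSum

end HasNonnegExpansion

end DiscExpansion

/-! ### The residue theorem at infinity for differentials on `X₀(2)`. -/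

section ConstantTerm

open Complex Filter Topology PowerSeries

/-- The nome `q = exp (2 π i τ)`. -/
noncomputable def nome (τ : ℂ) : ℂ := cexp (2 * Real.pi * I * τ)

lemma nome_ne_zero (τ : ℂ) : nome τ ≠ 0 := Complex.exp_ne_zero _

lemma norm_nome_lt_one {τ : ℂ} (h : 0 < τ.im) : ‖nome τ‖ < 1 := by
  rw [nome, Complex.norm_exp]
  have : (2 * (Real.pi : ℂ) * I * τ).re = -(2 * Real.pi * τ.im) := by simp
  rw [this, Real.exp_lt_one_iff]
  have := Real.pi_pos
  nlinarith [mul_pos this h]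

lemma nome_add_one (τ : ℂ) : nome (τ + 1) = nome τ := by
  rw [nome, nome, mul_add, mul_one, Complex.exp_add, Complex.exp_two_pi_mul_I, mul_one]

lemma hasDerivAt_nome (τ : ℂ) : HasDerivAt nome (2 * Real.pi * I * nome τ) τ := by
  have := ((hasDerivAt_id τ).const_mul (2 * (Real.pi : ℂ) * I)).cexp
  convert! this using 1
  simp [nome, mul_comm]

lemma im_neg_one_div_pos {τ : ℂ} (h : 0 < τ.im) : 0 < (-1 / τ).im := by
  have h0 : τ ≠ 0 := by rintro rfl; simp at h
  rw [neg_div, one_div, neg_im, inv_im, neg_div, neg_neg]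
  exact div_pos h (normSq_pos.2 h0)

/-- The constant term of a function `q⁻ᵐ g(q)` on the upper half-plane vanishes if the differential
form it defines extends by zero to the cusp `0`. -/
theorem coeff_eq_zero_of_inversion {g h : ℂ → ℂ} {p : ℂ⟦X⟧} (hg : HasDiscExpansion g p)
    (hh : DifferentiableOn ℂ h (Metric.ball 0 1)) (m : ℕ)
    (H : ∀ τ : ℂ, 0 < τ.im →
      g (nome (-1 / τ)) / nome (-1 / τ) ^ m / τ ^ 2 = nome (τ / 2) * h (nome (τ / 2))) :
    coeff m p = 0 := by
  obtain ⟨R, hR, hgR⟩ := hg.remainder (m + 1)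
  obtain ⟨P, hP⟩ := hR.differentiableOn.isExactOn_ball
  obtain ⟨K, hK⟩ := hh.isExactOn_ball
  have hpi : (2 * Real.pi * I : ℂ) ≠ 0 := two_pi_I_ne_zero
  -- A primitive of `q⁻ᵐ g` in `τ`. Every term but `coeff m p * τ` is a function of the nome, so
  -- this term alone obstructs period 1.
  let Φ : ℂ → ℂ := fun τ ↦ ∑ j ∈ Finset.range m,
    coeff j p / (2 * Real.pi * I * ((j : ℂ) - m)) * nome τ ^ ((j : ℤ) - m) +
      coeff m p * τ + P (nome τ) / (2 * Real.pi * I)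
  have hΦ (τ : ℂ) (hτ : 0 < τ.im) : HasDerivAt Φ (g (nome τ) / nome τ ^ m) τ := by
    have hq := norm_nome_lt_one hτ
    have hq0 := nome_ne_zero τ
    have h1 (j : ℕ) (hj : j ∈ Finset.range m) : HasDerivAt
        (fun τ ↦ coeff j p / (2 * Real.pi * I * ((j : ℂ) - m)) * nome τ ^ ((j : ℤ) - m))
        (coeff j p * nome τ ^ j / nome τ ^ m) τ := by
      have hjm : (j : ℂ) - m ≠ 0 := by
        rw [sub_ne_zero]; exact_mod_cast (Finset.mem_range.1 hj).ne
      have := ((hasDerivAt_zpow ((j : ℤ) - m) (nome τ) (.inl hq0)).comp τ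
        (hasDerivAt_nome τ)).const_mul (coeff j p / (2 * Real.pi * I * ((j : ℂ) - m)))
      convert! this using 1
      rw [zpow_sub_one₀ hq0, zpow_sub₀ hq0, zpow_natCast, zpow_natCast]
      push_cast
      field_simp
    have h2 := HasDerivAt.fun_sum h1
    have h3 : HasDerivAt (fun τ ↦ P (nome τ) / (2 * Real.pi * I)) (nome τ * R (nome τ)) τ := by
      have := ((hP (nome τ) (by simpa using hq)).comp τ (hasDerivAt_nome τ)).div_const
        (2 * Real.pi * I)
      convert! this using 1
      field_simp
    have h4 : HasDerivAt (fun τ ↦ coeff m p * τ) (coeff m p) τ := by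
      simpa using (hasDerivAt_id τ).const_mul (coeff m p)
    convert! (h2.add h4).add h3 using 1
    rw [hgR _ hq, Finset.sum_range_succ, ← Finset.sum_div, pow_succ]
    field_simp
  let Ψ : ℂ → ℂ := fun τ ↦ K (nome (τ / 2)) / (Real.pi * I)
  have hΨ (τ : ℂ) (hτ : 0 < τ.im) : HasDerivAt Ψ (nome (τ / 2) * h (nome (τ / 2))) τ := by
    have h2 : 0 < (τ / 2).im := by simpa using hτ
    have := ((hK (nome (τ / 2)) (by simpa using norm_nome_lt_one h2)).comp τ
      ((hasDerivAt_nome (τ / 2)).comp τ ((hasDerivAt_id τ).div_const 2))).div_const (Real.pi * I)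
    convert! this using 1
    have : (Real.pi : ℂ) ≠ 0 := by exact_mod_cast Real.pi_ne_zero
    field_simp
  have hD (τ : ℂ) (hτ : 0 < τ.im) : HasDerivAt (fun τ ↦ Φ (-1 / τ) - Ψ τ) 0 τ := by
    have h0 : τ ≠ 0 := by rintro rfl; simp at hτ
    have h1 : HasDerivAt (fun τ : ℂ ↦ -1 / τ) (1 / τ ^ 2) τ := by
      convert! (hasDerivAt_inv h0).const_mul (-1) using 1
      ring
    have := ((hΦ _ (im_neg_one_div_pos hτ)).comp τ h1).sub (hΨ τ hτ)
    convert! this using 1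
    rw [← H τ hτ]; ring
  have hU : IsOpen {τ : ℂ | 0 < τ.im} := isOpen_lt continuous_const Complex.continuous_im
  -- The points `-1 + i` and `1 + i` differ by the period 2 of `Ψ`, while their images `(1 + i)/2`
  -- and `(-1 + i)/2` under `τ ↦ -1/τ` differ by 1. Hence the constant term is the difference of two
  -- equal values.
  have hconst := hU.is_const_of_deriv_eq_zero (convex_halfSpace_im_gt 0).isPreconnected
    (fun τ hτ ↦ (hD τ hτ).differentiableAt.differentiableWithinAt) (fun τ hτ ↦ (hD τ hτ).deriv)
    (x := -1 + I) (y := -1 + I + 2) (by simp) (by simp)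
  have hΨ2 : Ψ (-1 + I + 2) = Ψ (-1 + I) := by
    simp only [Ψ]
    rw [add_div, div_self two_ne_zero, nome_add_one]
  have hΦ1 (τ : ℂ) : Φ (τ + 1) = Φ τ + coeff m p := by
    simp only [Φ, nome_add_one]; ring
  have e1 : -1 / (-1 + I) = (-1 + I) / 2 + 1 := by
    have : (-1 + I : ℂ) ≠ 0 := fun h ↦ by simpa using congrArg Complex.im h
    field_simp
    linear_combination -I_sq
  have e2 : -1 / (-1 + I + 2) = (-1 + I) / 2 := by
    have : (-1 + I + 2 : ℂ) ≠ 0 := fun h ↦ by simpa using congrArg Complex.im h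
    field_simp
    linear_combination -I_sq
  rw [hΨ2, e1, e2, hΦ1] at hconst
  linear_combination hconst

end ConstantTerm

/-! ### Two eta quotients of weight 4 and their inversion. -/

section EtaQuotients

open Complex Filter Topology PowerSeries

/-- Euler's product `∏ (1 - qⁿ)`. -/
noncomputable def eulerProd (q : ℂ) : ℂ := ∏' n : ℕ, (1 - q ^ (n + 1))

lemma norm_sq_lt_one {q : ℂ} (hq : ‖q‖ < 1) : ‖q ^ 2‖ < 1 := by
  rw [norm_pow]; exact pow_lt_one₀ (norm_nonneg _) hq two_ne_zero

lemma differentiableOn_eulerProd : DifferentiableOn ℂ eulerProd (Metric.ball 0 1) :=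
  ModularForm.differentiableOn_tprod_one_sub_pow

lemma eulerProd_ne_zero {q : ℂ} (hq : ‖q‖ < 1) : eulerProd q ≠ 0 := by
  refine tprod_one_add_ne_zero_of_summable (f := fun n ↦ -q ^ (n + 1)) (fun i h ↦ ?_) ?_
  · have h1 : q ^ (i + 1) = 1 := by linear_combination -h
    have h2 := congrArg norm h1
    rw [norm_pow, norm_one] at h2
    exact (pow_lt_one₀ (norm_nonneg q) hq i.succ_ne_zero).ne h2
  · simpa using (summable_nat_add_iff 1).mpr (summable_geometric_of_lt_one (norm_nonneg _) hq)

lemma eulerProd_zero : eulerProd 0 = 1 := by simp [eulerProd]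

lemma differentiableOn_eulerProd_sq :
    DifferentiableOn ℂ (fun q ↦ eulerProd (q ^ 2)) (Metric.ball 0 1) :=
  differentiableOn_eulerProd.comp (by fun_prop) fun q hq ↦ by
    simpa using norm_sq_lt_one (by simpa using hq)

/-- The function `∏ (1 - qⁿ)¹⁶ / (1 - q²ⁿ)⁸`, the expansion at infinity of `η(τ)¹⁶ / η(2τ)⁸`. -/
noncomputable def etaQuotA (q : ℂ) : ℂ := eulerProd q ^ 16 / eulerProd (q ^ 2) ^ 8

/-- The function `∏ (1 - q²ⁿ)¹⁶ / (1 - qⁿ)⁸`, where `q etaQuotB q` is the expansion at infinity of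
`η(2τ)¹⁶ / η(τ)⁸`. -/
noncomputable def etaQuotB (q : ℂ) : ℂ := eulerProd (q ^ 2) ^ 16 / eulerProd q ^ 8

lemma etaQuotA_ne_zero {q : ℂ} (hq : ‖q‖ < 1) : etaQuotA q ≠ 0 :=
  div_ne_zero (pow_ne_zero _ (eulerProd_ne_zero hq))
    (pow_ne_zero _ (eulerProd_ne_zero (norm_sq_lt_one hq)))

lemma etaQuotB_ne_zero {q : ℂ} (hq : ‖q‖ < 1) : etaQuotB q ≠ 0 :=
  div_ne_zero (pow_ne_zero _ (eulerProd_ne_zero (norm_sq_lt_one hq)))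
    (pow_ne_zero _ (eulerProd_ne_zero hq))

lemma differentiableOn_etaQuotA : DifferentiableOn ℂ etaQuotA (Metric.ball 0 1) :=
  (differentiableOn_eulerProd.pow 16).div (differentiableOn_eulerProd_sq.pow 8) fun _ hq ↦
    pow_ne_zero _ (eulerProd_ne_zero (norm_sq_lt_one (by simpa using hq)))

lemma differentiableOn_etaQuotB : DifferentiableOn ℂ etaQuotB (Metric.ball 0 1) :=
  (differentiableOn_eulerProd_sq.pow 16).div (differentiableOn_eulerProd.pow 8) fun _ hq ↦
    pow_ne_zero _ (eulerProd_ne_zero (by simpa using hq))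

lemma nome_two_mul (τ : ℂ) : nome (2 * τ) = nome τ ^ 2 := by
  rw [nome, nome, ← Complex.exp_nat_mul]; congr 1; push_cast; ring

lemma eta_eq_exp_mul_eulerProd (τ : ℂ) :
    ModularForm.eta τ = cexp (2 * Real.pi * I * τ / 24) * eulerProd (nome τ) := by
  simp [ModularForm.eta, eulerProd, nome, Function.Periodic.qParam, ModularForm.eta_q]

/-- The eighth power turns the square roots of `τ` and `i` in the inversion of `η` into `τ⁴` and `i⁴
= 1`. -/
lemma eta_neg_one_div_pow_eight {τ : ℂ} (hτ : 0 < τ.im) :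
    ModularForm.eta (-1 / τ) ^ 8 = τ ^ 4 * ModularForm.eta τ ^ 8 := by
  have h0 : τ ≠ 0 := by rintro rfl; simp at hτ
  have hs (z : ℂ) (hz : z ≠ 0) : Complex.sqrt z ^ 8 = z ^ 4 := by
    rw [Complex.sqrt, cpow_def_of_ne_zero hz, ← exp_nat_mul]
    rw [show ((8 : ℕ) : ℂ) * (log z * 2⁻¹) = (4 : ℕ) * log z by push_cast; ring, exp_nat_mul,
      exp_log hz]
  have h := ModularForm.eta_comp_eq_csqrt_I_inv hτ
  simp only [Function.comp_apply, Pi.smul_apply, Pi.mul_apply, smul_eq_mul] at h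
  rw [h, mul_pow, mul_pow, inv_pow, hs _ I_ne_zero, hs _ h0, I_pow_four, inv_one, one_mul]

lemma etaQuotA_nome (τ : ℂ) :
    etaQuotA (nome τ) = ModularForm.eta τ ^ 16 / ModularForm.eta (2 * τ) ^ 8 := by
  have h : cexp (2 * Real.pi * I * τ / 24) ^ 16 = cexp (2 * Real.pi * I * (2 * τ) / 24) ^ 8 := by
    rw [← exp_nat_mul, ← exp_nat_mul]; congr 1; push_cast; ring
  rw [eta_eq_exp_mul_eulerProd, eta_eq_exp_mul_eulerProd, mul_pow, mul_pow, h,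
    mul_div_mul_left _ _ (pow_ne_zero _ (exp_ne_zero _)), nome_two_mul, etaQuotA]

lemma nome_mul_etaQuotB_nome (τ : ℂ) :
    nome τ * etaQuotB (nome τ) = ModularForm.eta (2 * τ) ^ 16 / ModularForm.eta τ ^ 8 := by
  have h : cexp (2 * Real.pi * I * (2 * τ) / 24) ^ 16 =
      cexp (2 * Real.pi * I * τ / 24) ^ 8 * nome τ := by
    rw [nome, ← exp_nat_mul, ← exp_nat_mul, ← exp_add]; congr 1; push_cast; ring
  rw [eta_eq_exp_mul_eulerProd, eta_eq_exp_mul_eulerProd, mul_pow, mul_pow, h, mul_assoc,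
    mul_div_mul_left _ _ (pow_ne_zero _ (exp_ne_zero _)), nome_two_mul, etaQuotB, mul_div_assoc]

/-- As `2(-1/τ) = -1/(τ/2)`, the arguments `-1/τ` and `2(-1/τ)` lead to `τ` and `τ/2`. Relative to
`τ/2` the roles of the single and the doubled argument are swapped, which exchanges the two
quotients. -/
lemma etaQuotA_inversion {τ : ℂ} (hτ : 0 < τ.im) :
    etaQuotA (nome (-1 / τ)) = 16 * τ ^ 4 * (nome (τ / 2) * etaQuotB (nome (τ / 2))) := by
  have h0 : τ ≠ 0 := by rintro rfl; simp at hτ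
  have h2 : 0 < (τ / 2).im := by simpa using hτ
  have e1 : 2 * (-1 / τ) = -1 / (τ / 2) := by field_simp
  have hη := ModularForm.eta_ne_zero h2
  rw [etaQuotA_nome, nome_mul_etaQuotB_nome, e1, eta_neg_one_div_pow_eight h2,
    show ModularForm.eta (-1 / τ) ^ 16 = (ModularForm.eta (-1 / τ) ^ 8) ^ 2 by ring,
    eta_neg_one_div_pow_eight hτ, mul_div_cancel₀ _ two_ne_zero]
  field_simp
  ring

lemma etaQuotB_inversion {τ : ℂ} (hτ : 0 < τ.im) :
    nome (-1 / τ) * etaQuotB (nome (-1 / τ)) = τ ^ 4 / 256 * etaQuotA (nome (τ / 2)) := by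
  have h0 : τ ≠ 0 := by rintro rfl; simp at hτ
  have h2 : 0 < (τ / 2).im := by simpa using hτ
  have e1 : 2 * (-1 / τ) = -1 / (τ / 2) := by field_simp
  have hη := ModularForm.eta_ne_zero hτ
  rw [etaQuotA_nome, nome_mul_etaQuotB_nome, e1, eta_neg_one_div_pow_eight hτ,
    show ModularForm.eta (-1 / (τ / 2)) ^ 16 = (ModularForm.eta (-1 / (τ / 2)) ^ 8) ^ 2 by ring,
    eta_neg_one_div_pow_eight h2, mul_div_cancel₀ _ two_ne_zero]
  field_simp
  ring

end EtaQuotients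

/-! ### Positivity of coefficients after replacing `q` by `-q`. -/

section Positivity

open Complex Filter Topology PowerSeries

open scoped ComplexOrder

/-- The product `∏ (1 + q²ⁿ⁺¹)`. -/
noncomputable def oddProd (q : ℂ) : ℂ := ∏' n : ℕ, (1 + q ^ (2 * n + 1))

lemma multipliable_oddProd {q : ℂ} (hq : ‖q‖ < 1) :
    Multipliable fun n : ℕ ↦ 1 + q ^ (2 * n + 1) := by
  refine multipliable_one_add_of_summable ?_
  have h := (summable_geometric_of_lt_one (norm_nonneg _) hq).comp_injective
    (i := fun n : ℕ ↦ 2 * n + 1) fun a b h ↦ by simpa using h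
  simpa [Function.comp_def] using h

lemma tendsto_oddProd {q : ℂ} (hq : ‖q‖ < 1) :
    Tendsto (fun N ↦ ∏ n ∈ Finset.range N, (1 + q ^ (2 * n + 1))) atTop (𝓝 (oddProd q)) :=
  (multipliable_oddProd hq).hasProd.tendsto_prod_nat

lemma tendsto_eulerProd {q : ℂ} (hq : ‖q‖ < 1) :
    Tendsto (fun N ↦ ∏ n ∈ Finset.range N, (1 - q ^ (n + 1))) atTop (𝓝 (eulerProd q)) :=
  (ModularForm.multipliable_one_sub_pow hq).hasProd.tendsto_prod_nat

lemma oddProd_zero : oddProd 0 = 1 := by simp [oddProd]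

/-- Factors with even exponent are unchanged by `q ↦ -q`, and those with odd exponent form
`oddProd`. Partial products of `2 * N` factors are compared. -/
lemma eulerProd_neg {q : ℂ} (hq : ‖q‖ < 1) :
    eulerProd (-q) = oddProd q * eulerProd (q ^ 2) := by
  have h1 := (tendsto_eulerProd (q := -q) (by simpa using hq)).comp
    (tendsto_id.const_mul_atTop' (show 0 < 2 by norm_num))
  refine tendsto_nhds_unique h1
    (((tendsto_oddProd hq).mul (tendsto_eulerProd (norm_sq_lt_one hq))).congr fun N ↦ ?_)
  simp only [Function.comp_apply, id]
  induction N with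
  | zero => simp
  | succ N ih =>
    rw [Finset.prod_range_succ, Finset.prod_range_succ, show 2 * (N + 1) = 2 * N + 1 + 1 by ring,
      Finset.prod_range_succ, Finset.prod_range_succ, ← ih]
    have e1 : (-q) ^ (2 * N + 1) = -q ^ (2 * N + 1) := Odd.neg_pow ⟨N, rfl⟩ q
    have e2 : (-q) ^ (2 * N + 1 + 1) = (q ^ 2) ^ (N + 1) := by
      rw [Even.neg_pow ⟨N + 1, by ring⟩, ← pow_mul]; ring
    rw [e1, e2]; ring

lemma hasNonnegExpansion_one_add_pow (m : ℕ) : HasNonnegExpansion fun q ↦ 1 + q ^ m :=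
  HasNonnegExpansion.one.add (HasNonnegExpansion.id.pow m)

/-- The coefficients of `∏ (1 + q²ⁿ⁺¹)` are nonnegative, and the first two are positive. -/
lemma exists_expansion_oddProd : ∃ p : ℂ⟦X⟧, (∀ n, 0 ≤ coeff n p) ∧ 0 < coeff 0 p ∧
    0 < coeff 1 p ∧ HasDiscExpansion oddProd p := by
  have hs {q : ℂ} (hq : ‖q‖ < 1) : Multipliable fun n : ℕ ↦ 1 + q ^ (2 * (n + 1) + 1) := by
    refine multipliable_one_add_of_summable ?_
    have h := (summable_geometric_of_lt_one (norm_nonneg _) hq).comp_injective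
      (i := fun n : ℕ ↦ 2 * (n + 1) + 1) fun a b h ↦ by simpa using h
    simpa [Function.comp_def] using h
  -- The factor `1 + q` is split off to make the first two coefficients visibly positive; of the
  -- rest only nonnegativity and the constant term 1 matter.
  obtain ⟨r, hr, hfr⟩ : HasNonnegExpansion fun q ↦ ∏' n : ℕ, (1 + q ^ (2 * (n + 1) + 1)) :=
    HasNonnegExpansion.of_tendsto
      (fun N ↦ HasNonnegExpansion.prod (Finset.range N)
        fun n _ ↦ hasNonnegExpansion_one_add_pow (2 * (n + 1) + 1))
      fun q hq ↦ (hs hq).hasProd.tendsto_prod_nat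
  have h1 : HasDiscExpansion (fun q ↦ 1 + q) (1 + X) := HasDiscExpansion.one.add .X
  have hn (n : ℕ) : 0 ≤ coeff n (1 + X : ℂ⟦X⟧) := by
    rw [map_add, PowerSeries.coeff_one, PowerSeries.coeff_X]
    exact add_nonneg (by split_ifs <;> simp) (by split_ifs <;> simp)
  have hr0 : coeff 0 r = 1 := by rw [hfr.coeff_zero]; simp
  refine ⟨(1 + X) * r, coeff_mul_nonneg hn hr, ?_, ?_, (h1.mul hfr).congr fun q hq ↦ ?_⟩
  · refine lt_of_lt_of_le ?_ (coeff_mul_coeff_le hn hr 0 0)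
    rw [hr0]; simp
  · refine lt_of_lt_of_le ?_ (coeff_mul_coeff_le hn hr 1 0)
    rw [hr0]; simp [PowerSeries.coeff_one]
  · simpa [oddProd] using tprod_eq_zero_mul' (f := fun n : ℕ ↦ 1 + q ^ (2 * n + 1)) (hs hq)

/-- Taking the linear term from `j` of the factors and the constant term from the others gives a
positive contribution. -/
lemma coeff_pow_pos {p : ℂ⟦X⟧} (hp : ∀ n, 0 ≤ coeff n p) (h0 : 0 < coeff 0 p)
    (h1 : 0 < coeff 1 p) {N j : ℕ} (hj : j ≤ N) :
    (∀ n, 0 ≤ coeff n (p ^ N)) ∧ 0 < coeff j (p ^ N) := by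
  induction N generalizing j with
  | zero =>
    obtain rfl : j = 0 := by omega
    exact ⟨fun n ↦ by rw [pow_zero, PowerSeries.coeff_one]; split_ifs <;> simp, by simp⟩
  | succ N ih =>
    have hN := (ih (Nat.zero_le N)).1
    rw [pow_succ]
    refine ⟨coeff_mul_nonneg hN hp, ?_⟩
    cases j with
    | zero => exact (mul_pos (ih (Nat.zero_le N)).2 h0).trans_le (coeff_mul_coeff_le hN hp 0 0)
    | succ j => exact (mul_pos (ih (by omega)).2 h1).trans_le (coeff_mul_coeff_le hN hp j 1)

lemma hasNonnegExpansion_inv_one_sub_pow {m : ℕ} (hm : m ≠ 0) :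
    HasNonnegExpansion fun q ↦ (1 - q ^ m)⁻¹ := by
  refine HasNonnegExpansion.of_tendsto
    (F := fun N q ↦ ∑ i ∈ Finset.range N, (q ^ m) ^ i)
    (fun N ↦ HasNonnegExpansion.sum _ fun i _ ↦ (HasNonnegExpansion.id.pow m).pow i)
    fun q hq ↦ (hasSum_geometric_of_norm_lt_one ?_).tendsto_sum_nat
  rw [norm_pow]; exact pow_lt_one₀ (norm_nonneg _) hq hm

lemma hasNonnegExpansion_inv_eulerProd_sq :
    HasNonnegExpansion fun q ↦ (eulerProd (q ^ 2))⁻¹ := by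
  refine HasNonnegExpansion.of_tendsto
    (F := fun N q ↦ ∏ n ∈ Finset.range N, (1 - q ^ (2 * (n + 1)))⁻¹)
    (fun N ↦ HasNonnegExpansion.prod _ fun n _ ↦ hasNonnegExpansion_inv_one_sub_pow (by omega))
    fun q hq ↦ ?_
  have h := (tendsto_eulerProd (norm_sq_lt_one hq)).inv₀ (eulerProd_ne_zero (norm_sq_lt_one hq))
  simpa [← pow_mul] using h

/-- The coefficients of `∏ (1 + q²ⁿ⁺¹)ᴺ (1 - q²ⁿ)⁻ᴹ` up to the `N`-th are positive. -/
lemma exists_expansion_oddProd_pow_mul (N M : ℕ) : ∃ p : ℂ⟦X⟧, (∀ n, 0 ≤ coeff n p) ∧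
    (∀ j ≤ N, 0 < coeff j p) ∧
    HasDiscExpansion (fun q ↦ oddProd q ^ N * ((eulerProd (q ^ 2))⁻¹) ^ M) p := by
  obtain ⟨p, hp, hp0, hp1, hfp⟩ := exists_expansion_oddProd
  obtain ⟨r, hr, hgr⟩ := hasNonnegExpansion_inv_eulerProd_sq.pow M
  have hr0 : coeff 0 r = 1 := by rw [hgr.coeff_zero]; simp [eulerProd_zero]
  have hN := (coeff_pow_pos hp hp0 hp1 (Nat.zero_le N)).1
  refine ⟨p ^ N * r, coeff_mul_nonneg hN hr, fun j hj ↦ ?_, (hfp.pow N).mul hgr⟩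
  refine lt_of_lt_of_le ?_ (coeff_mul_coeff_le hN hr j 0)
  rw [hr0, mul_one]
  exact (coeff_pow_pos hp hp0 hp1 hj).2

lemma etaQuotB_neg_inv {q : ℂ} (hq : ‖q‖ < 1) :
    (etaQuotB (-q))⁻¹ = oddProd q ^ 8 * ((eulerProd (q ^ 2))⁻¹) ^ 8 := by
  have h := eulerProd_ne_zero (norm_sq_lt_one hq)
  rw [etaQuotB, neg_sq, eulerProd_neg hq]
  field_simp

lemma etaQuotA_neg {q : ℂ} (hq : ‖q‖ < 1) :
    etaQuotA (-q) = (oddProd q ^ 2 * eulerProd (q ^ 2)) ^ 8 := by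
  have h := eulerProd_ne_zero (norm_sq_lt_one hq)
  rw [etaQuotA, neg_sq, eulerProd_neg hq]
  field_simp

/-- At `-q` the function is `∏ (1 + q²ⁿ⁺¹)^(24+8k) (1 - q²ⁿ)^(-8k)`: one factor of `etaQuotB⁻¹`
absorbs the numerator `eulerProd (q ^ 2) ^ 8` of `etaQuotA`. The substitution only changes signs of
coefficients. -/
lemma coeff_etaQuotA_div_etaQuotB_ne_zero {k : ℕ} {p : ℂ⟦X⟧}
    (hp : HasDiscExpansion (fun q ↦ etaQuotA q * (etaQuotB q)⁻¹ ^ (k + 1)) p) :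
    coeff (k + 1) p ≠ 0 := by
  obtain ⟨r, -, hr, hfr⟩ := exists_expansion_oddProd_pow_mul (24 + 8 * k) (8 * k)
  have h := hp.comp_neg.unique (hfr.congr fun q hq ↦ by
    have h := eulerProd_ne_zero (norm_sq_lt_one hq)
    rw [etaQuotB_neg_inv hq, etaQuotA_neg hq, ← mul_pow, ← pow_mul, mul_add, pow_add, mul_one,
      inv_pow, mul_pow, mul_pow, mul_pow, inv_pow, inv_pow, pow_add]
    field_simp)
  intro h0
  have := hr (k + 1) (by omega)
  rw [← h, coeff_rescale, h0] at this
  simp at this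

end Positivity

/-! ### Gaussian binomials and a finite triple product identity. -/

section TripleProduct

open Complex Filter Topology PowerSeries

open scoped ComplexOrder

/-- Gaussian binomial coefficients evaluated at `Q`. -/
def gaussBinom (Q : ℂ) : ℕ → ℕ → ℂ
  | _, 0 => 1
  | 0, _ + 1 => 0
  -- Truncation of `M - r` is harmless, as `gaussBinom Q M r` vanishes for `r > M`.
  | M + 1, r + 1 => gaussBinom Q M (r + 1) + Q ^ (M - r) * gaussBinom Q M r

lemma gaussBinom_zero_right (Q : ℂ) (M : ℕ) : gaussBinom Q M 0 = 1 := by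
  cases M <;> rw [gaussBinom]

lemma gaussBinom_eq_zero (Q : ℂ) {M r : ℕ} (h : M < r) : gaussBinom Q M r = 0 := by
  induction M generalizing r with
  | zero => cases r with
    | zero => omega
    | succ r => rw [gaussBinom]
  | succ M ih => cases r with
    | zero => omega
    | succ r => rw [gaussBinom, ih (by omega), ih (by omega)]; simp

/-- The `q`-binomial theorem. -/
lemma prod_add_mul_pow_eq_sum_gaussBinom (Q x y : ℂ) (M : ℕ) :
    ∏ j ∈ Finset.range M, (y + x * Q ^ j) = ∑ r ∈ Finset.range (M + 1),
      Q ^ (r.choose 2) * x ^ r * y ^ (M - r) * gaussBinom Q M r := by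
  induction M with
  | zero => simp [gaussBinom]
  | succ M ih =>
    rw [Finset.prod_range_succ, ih, mul_add, Finset.sum_mul, Finset.sum_mul,
      Finset.sum_range_succ' _ (M + 1), Finset.sum_range_succ' _ M]
    have h1 : ∀ r ∈ Finset.range (M + 1),
        Q ^ ((r + 1).choose 2) * x ^ (r + 1) * y ^ (M + 1 - (r + 1)) * gaussBinom Q (M + 1) (r + 1)
        = Q ^ ((r + 1).choose 2) * x ^ (r + 1) * y ^ (M - r) * gaussBinom Q M (r + 1) +
          Q ^ (r.choose 2) * x ^ r * y ^ (M - r) * gaussBinom Q M r * (x * Q ^ M) := by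
      intro r hr
      have hr : r ≤ M := by simpa [Nat.lt_succ_iff] using hr
      have e : Q ^ ((r + 1).choose 2) * Q ^ (M - r) = Q ^ (r.choose 2) * Q ^ M := by
        have hc : (r + 1).choose 2 = r + r.choose 2 := by
          rw [Nat.choose_succ_succ' r 1, Nat.choose_one_right]
        rw [← pow_add, ← pow_add, hc]
        congr 1
        omega
      rw [gaussBinom, Nat.add_sub_add_right]
      linear_combination (x ^ (r + 1) * y ^ (M - r) * gaussBinom Q M r) * e
    rw [Finset.sum_congr rfl h1, Finset.sum_add_distrib, Finset.sum_range_succ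
      (fun r ↦ Q ^ ((r + 1).choose 2) * x ^ (r + 1) * y ^ (M - r) * gaussBinom Q M (r + 1)) M,
      gaussBinom_eq_zero Q (Nat.lt_succ_self M)]
    have h2 : ∀ r ∈ Finset.range M,
        Q ^ ((r + 1).choose 2) * x ^ (r + 1) * y ^ (M - (r + 1)) * gaussBinom Q M (r + 1) * y =
        Q ^ ((r + 1).choose 2) * x ^ (r + 1) * y ^ (M - r) * gaussBinom Q M (r + 1) := by
      intro r hr
      have hr := Finset.mem_range.1 hr
      rw [show M - r = M - (r + 1) + 1 by omega, pow_succ]; ring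
    rw [Finset.sum_congr rfl h2]
    simp only [gaussBinom_zero_right, Nat.sub_zero, pow_succ]
    ring

/-- The induction rests on `1 - Q^(M+1) = (1 - Q^(M-r)) + Q^(M-r) (1 - Q^(r+1))`. With denominators
cleared, roots of unity need not be excluded. -/
lemma gaussBinom_mul_prod (Q : ℂ) {M r : ℕ} (h : r ≤ M) :
    gaussBinom Q M r * (∏ j ∈ Finset.range r, (1 - Q ^ (j + 1))) *
      (∏ j ∈ Finset.range (M - r), (1 - Q ^ (j + 1))) = ∏ j ∈ Finset.range M, (1 - Q ^ (j + 1)) := by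
  induction M generalizing r with
  | zero =>
    obtain rfl : r = 0 := by omega
    simp [gaussBinom]
  | succ M ih => cases r with
    | zero => simp [gaussBinom]
    | succ r =>
      have hr : r ≤ M := by omega
      have h1 := ih hr
      rw [gaussBinom, Nat.add_sub_add_right, Finset.prod_range_succ _ M]
      rcases hr.eq_or_lt with rfl | hlt
      · rw [gaussBinom_eq_zero Q (Nat.lt_succ_self r), Finset.prod_range_succ]
        simp only [Nat.sub_self, Finset.range_zero, Finset.prod_empty, pow_zero] at h1 ⊢
        linear_combination (1 - Q ^ (r + 1)) * h1
      · have h2 := ih (r := r + 1) hlt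
        have e : M - r = M - (r + 1) + 1 := by omega
        have e2 : Q ^ (M + 1) = Q ^ (M - r) * Q ^ (r + 1) := by rw [← pow_add]; congr 1; omega
        have h3 : (∏ j ∈ Finset.range (M - r), (1 - Q ^ (j + 1))) =
            (∏ j ∈ Finset.range (M - (r + 1)), (1 - Q ^ (j + 1))) * (1 - Q ^ (M - r)) := by
          rw [e, Finset.prod_range_succ]
        rw [h3] at h1
        rw [Finset.prod_range_succ] at h2
        rw [h3, e2, Finset.prod_range_succ]
        linear_combination (1 - Q ^ (M - r)) * h2 + (Q ^ (M - r) * (1 - Q ^ (r + 1))) * h1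

/-- A finite form of Jacobi's triple product identity at `z = 1`. -/
lemma prod_one_add_pow_sq_eq_sum {q : ℂ} (hq : q ≠ 0) (N : ℕ) :
    (∏ j ∈ Finset.range N, (1 + q ^ (2 * j + 1))) ^ 2 = ∑ r ∈ Finset.range (2 * N + 1),
      q ^ (((r : ℤ) - N).natAbs ^ 2) * gaussBinom (q ^ 2) (2 * N) r := by
  rcases Nat.eq_zero_or_pos N with rfl | hN
  · simp [gaussBinom]
  -- The factors are `q^(2N-1) + q^(2j)`. Extracting `q^(2j)` for `j < N` and `q^(2N-1)` for `j ≥ N`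
  -- leaves each `1 + q^(2i+1)` with `i < N` twice, and the extracted exponent is `N(N-1) + N(2N-1)
  -- = 3N² - 2N`.
  have h := prod_add_mul_pow_eq_sum_gaussBinom (q ^ 2) 1 (q ^ (2 * N - 1)) (2 * N)
  have hpow : q ^ (3 * N ^ 2 - 2 * N) ≠ 0 := pow_ne_zero _ hq
  refine mul_left_cancel₀ hpow ?_
  rw [Finset.mul_sum]
  have hR : ∀ r ∈ Finset.range (2 * N + 1),
      q ^ (3 * N ^ 2 - 2 * N) * (q ^ (((r : ℤ) - N).natAbs ^ 2) * gaussBinom (q ^ 2) (2 * N) r) =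
      (q ^ 2) ^ (r.choose 2) * 1 ^ r * (q ^ (2 * N - 1)) ^ (2 * N - r) *
        gaussBinom (q ^ 2) (2 * N) r := by
    intro r hr
    have hr : r ≤ 2 * N := by simpa [Nat.lt_succ_iff] using hr
    rw [one_pow, mul_one, ← mul_assoc, ← pow_add, ← pow_mul, ← pow_mul, ← pow_add]
    congr 2
    have e1 : 2 * N ≤ 3 * N ^ 2 := by nlinarith
    have e2 : 2 * r.choose 2 = r * (r - 1) := by
      rw [Nat.choose_two_right, Nat.mul_div_cancel' (Nat.even_mul_pred_self r).two_dvd]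
    rw [e2]
    zify [e1, hr, show 1 ≤ 2 * N by omega]
    rw [sq_abs]
    rcases Nat.eq_zero_or_pos r with rfl | hr0
    · push_cast; ring
    · push_cast [Nat.cast_sub hr0]; ring
  rw [Finset.sum_congr rfl hR, ← h]
  rw [show 2 * N = N + N by ring, Finset.prod_range_add,
    ← Finset.prod_range_reflect (fun j ↦ q ^ (N + N - 1) + 1 * (q ^ 2) ^ j) N]
  have f1 : ∀ j ∈ Finset.range N, q ^ (N + N - 1) + 1 * (q ^ 2) ^ (N - 1 - j) =
      q ^ (2 * (N - 1 - j)) * (1 + q ^ (2 * j + 1)) := by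
    intro j hj
    have hj := Finset.mem_range.1 hj
    rw [mul_add, ← pow_add, ← pow_mul, show N + N - 1 = 2 * (N - 1 - j) + (2 * j + 1) by omega]
    ring
  have f2 : ∀ j ∈ Finset.range N, q ^ (N + N - 1) + 1 * (q ^ 2) ^ (N + j) =
      q ^ (2 * N - 1) * (1 + q ^ (2 * j + 1)) := by
    intro j _
    rw [mul_add, ← pow_add, ← pow_mul, show 2 * (N + j) = 2 * N - 1 + (2 * j + 1) by omega,
      show N + N - 1 = 2 * N - 1 by omega]
    ring
  rw [Finset.prod_congr rfl f1, Finset.prod_congr rfl f2, Finset.prod_mul_distrib,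
    Finset.prod_mul_distrib, Finset.prod_const, Finset.card_range,
    Finset.prod_range_reflect (fun j ↦ q ^ (2 * j)) N, Finset.prod_pow_eq_pow_sum,
    ← Finset.mul_sum, mul_comm 2, Finset.sum_range_id_mul_two, ← pow_mul]
  have e : q ^ (3 * N ^ 2 - (N + N)) = q ^ (N * (N - 1)) * q ^ ((2 * N - 1) * N) := by
    rw [← pow_add]
    congr 1
    have e1 : N + N ≤ 3 * N ^ 2 := by nlinarith
    zify [e1, hN, show 1 ≤ 2 * N by omega]
    ring
  rw [← mul_two] at e ⊢
  linear_combination (∏ j ∈ Finset.range N, (1 + q ^ (2 * j + 1))) ^ 2 * e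

end TripleProduct

/-! ### Gauss's identity, and positivity for the differentiated eta quotient. -/

section SquareSeries

open Complex Filter Topology PowerSeries

open scoped ComplexOrder

lemma summable_norm_pow_natAbs_sq {q : ℂ} (hq : ‖q‖ < 1) :
    Summable fun n : ℤ ↦ ‖q‖ ^ (n.natAbs ^ 2) := by
  have h : Summable fun n : ℕ ↦ ‖q‖ ^ (n ^ 2) :=
    (summable_geometric_of_lt_one (norm_nonneg _) hq).of_nonneg_of_le (fun _ ↦ by positivity)
      fun n ↦ pow_le_pow_of_le_one (norm_nonneg _) hq.le (Nat.le_self_pow two_ne_zero n)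
  exact .of_nat_of_neg (by simpa using h) (by simpa using h)

/-- Gauss's identity `∏ (1 + q²ⁿ⁻¹)² (1 - q²ⁿ) = ∑ q^(n²)`. -/
lemma oddProd_sq_mul_eulerProd_sq {q : ℂ} (hq : ‖q‖ < 1) :
    oddProd q ^ 2 * eulerProd (q ^ 2) = ∑' n : ℤ, q ^ (n.natAbs ^ 2) := by
  rcases eq_or_ne q 0 with rfl | hq0
  · rw [tsum_eq_single 0 fun n hn ↦ by simpa using hn]
    simp [oddProd_zero, eulerProd_zero]
  set Q := q ^ 2 with hQ
  have hQ1 : ‖Q‖ < 1 := norm_sq_lt_one hq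
  let P : ℕ → ℂ := fun n ↦ ∏ j ∈ Finset.range n, (1 - Q ^ (j + 1))
  have hP : Tendsto P atTop (𝓝 (eulerProd Q)) := tendsto_eulerProd hQ1
  have hP0 (n : ℕ) : P n ≠ 0 := by
    refine Finset.prod_ne_zero_iff.2 fun j _ h ↦ ?_
    have h1 : Q ^ (j + 1) = 1 := by linear_combination -h
    have h2 := congrArg norm h1
    rw [norm_pow, norm_one] at h2
    exact (pow_lt_one₀ (norm_nonneg Q) hQ1 j.succ_ne_zero).ne h2
  have hE := eulerProd_ne_zero hQ1
  have hPi : Tendsto (fun n ↦ (P n)⁻¹) atTop (𝓝 (eulerProd Q)⁻¹) := hP.inv₀ hE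
  obtain ⟨C, hC⟩ := hP.norm.bddAbove_range
  obtain ⟨D, hD⟩ := hPi.norm.bddAbove_range
  have hC' (n : ℕ) : ‖P n‖ ≤ C := hC ⟨n, rfl⟩
  have hD' (n : ℕ) : ‖(P n)⁻¹‖ ≤ D := hD ⟨n, rfl⟩
  have hC0 : 0 ≤ C := (norm_nonneg _).trans (hC' 0)
  have hD0 : 0 ≤ D := (norm_nonneg _).trans (hD' 0)
  have hG {M r : ℕ} (h : r ≤ M) : gaussBinom Q M r = P M * (P r)⁻¹ * (P (M - r))⁻¹ := by
    rw [eq_mul_inv_iff_mul_eq₀ (hP0 _), eq_mul_inv_iff_mul_eq₀ (hP0 _), mul_right_comm]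
    exact gaussBinom_mul_prod Q h
  let f : ℕ → ℤ → ℂ := fun N n ↦
    -- For `n < -N` the truncation `toNat` would give index 0 and binomial 1; for `n > N` the
    -- binomial vanishes by itself.
    if -(N : ℤ) ≤ n then q ^ (n.natAbs ^ 2) * gaussBinom Q (2 * N) (n + N).toNat else 0
  have hsum (N : ℕ) : ∑' n, f N n = (∏ j ∈ Finset.range N, (1 + q ^ (2 * j + 1))) ^ 2 := by
    rw [prod_one_add_pow_sq_eq_sum hq0, tsum_eq_sum
      (s := (Finset.range (2 * N + 1)).map ⟨fun r : ℕ ↦ (r : ℤ) - N, fun a b h ↦ by simpa using h⟩)]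
    · rw [Finset.sum_map]
      refine Finset.sum_congr rfl fun r _ ↦ ?_
      change f N ((r : ℤ) - N) = _
      simp [f, hQ]
    · intro n hn
      simp only [f]
      split_ifs with h
      · rw [gaussBinom_eq_zero, mul_zero]
        by_contra hlt
        refine hn (Finset.mem_map.2 ⟨(n + N).toNat, ?_, ?_⟩)
        · simp; omega
        · change ((n + N).toNat : ℤ) - N = n
          omega
      · rfl
  have hbound (N : ℕ) (n : ℤ) : ‖f N n‖ ≤ ‖q‖ ^ (n.natAbs ^ 2) * (C * D * D) := by
    simp only [f]
    split_ifs with h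
    · rw [norm_mul, norm_pow]
      refine mul_le_mul_of_nonneg_left ?_ (by positivity)
      rcases le_or_gt (n + N).toNat (2 * N) with hle | hlt
      · rw [hG hle, norm_mul, norm_mul]
        gcongr
        · exact hC' _
        · exact hD' _
        · exact hD' _
      · rw [gaussBinom_eq_zero Q hlt, norm_zero]; positivity
    · rw [norm_zero]; positivity
  -- The binomial is `P (2N) / (P (N+n) P (N-n))`, and all three products tend to `eulerProd Q`.
  have hlim (n : ℤ) : Tendsto (fun N ↦ f N n) atTop (𝓝 (q ^ (n.natAbs ^ 2) * (eulerProd Q)⁻¹)) := by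
    have t1 : Tendsto (fun N : ℕ ↦ 2 * N) atTop atTop :=
      tendsto_id.const_mul_atTop' (show 0 < 2 by norm_num)
    have t2 : Tendsto (fun N : ℕ ↦ (n + N).toNat) atTop atTop :=
      tendsto_atTop_mono (f := fun N ↦ N - n.natAbs) (fun N ↦ by omega) (tendsto_sub_atTop_nat _)
    have t3 : Tendsto (fun N : ℕ ↦ 2 * N - (n + N).toNat) atTop atTop :=
      tendsto_atTop_mono (f := fun N ↦ N - n.natAbs) (fun N ↦ by omega) (tendsto_sub_atTop_nat _)
    have h := (((hP.comp t1).mul (hPi.comp t2)).mul (hPi.comp t3)).const_mul (q ^ (n.natAbs ^ 2))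
    rw [mul_inv_cancel₀ hE, one_mul] at h
    refine h.congr' ?_
    filter_upwards [eventually_ge_atTop n.natAbs] with N hN
    simp only [f, Function.comp_apply]
    rw [if_pos (by omega), hG (by omega)]
  have h := tendsto_tsum_of_dominated_convergence
    ((summable_norm_pow_natAbs_sq hq).mul_right (C * D * D)) hlim (.of_forall hbound)
  simp only [hsum] at h
  have h' := tendsto_nhds_unique h ((tendsto_oddProd hq).pow 2)
  rw [← h', tsum_mul_right, mul_assoc, inv_mul_cancel₀ hE, mul_one]

/-- The coefficients of `∑ q^(n²)` are nonnegative, and the first two are positive. -/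
lemma exists_expansion_oddProd_sq_mul : ∃ p : ℂ⟦X⟧, (∀ n, 0 ≤ coeff n p) ∧ 0 < coeff 0 p ∧
    0 < coeff 1 p ∧ HasDiscExpansion (fun q ↦ oddProd q ^ 2 * eulerProd (q ^ 2)) p := by
  have hs {q : ℂ} (hq : ‖q‖ < 1) : Summable fun n : ℤ ↦ q ^ (n.natAbs ^ 2) :=
    .of_norm (by simpa using summable_norm_pow_natAbs_sq hq)
  have hp {q : ℂ} (hq : ‖q‖ < 1) : Summable fun n : ℕ ↦ q ^ (n ^ 2) := by
    simpa [Function.comp_def] using (hs hq).comp_injective Nat.cast_injective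
  obtain ⟨r, hr, hfr⟩ : HasNonnegExpansion fun q ↦
      ∑' n : ℕ, q ^ ((n + 2) ^ 2) + ∑' n : ℕ, q ^ ((n + 1) ^ 2) := by
    have hnat (m : ℕ) {q : ℂ} (hq : ‖q‖ < 1) : Summable fun n : ℕ ↦ q ^ ((n + m) ^ 2) :=
      (summable_nat_add_iff (f := fun n : ℕ ↦ q ^ (n ^ 2)) m).2 (hp hq)
    have h (m : ℕ) : HasNonnegExpansion fun q ↦ ∑' n : ℕ, q ^ ((n + m) ^ 2) :=
      HasNonnegExpansion.of_tendsto
        (fun N ↦ HasNonnegExpansion.sum (Finset.range N)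
          fun n _ ↦ HasNonnegExpansion.id.pow ((n + m) ^ 2))
        fun q hq ↦ (hnat m hq).hasSum.tendsto_sum_nat
    exact (h 2).add (h 1)
  have hn (n : ℕ) : 0 ≤ coeff n (1 + X : ℂ⟦X⟧) := by
    rw [map_add, PowerSeries.coeff_one, PowerSeries.coeff_X]
    exact add_nonneg (by split_ifs <;> simp) (by split_ifs <;> simp)
  refine ⟨1 + X + r, fun n ↦ by rw [map_add]; exact add_nonneg (hn n) (hr n), ?_, ?_,
    ((HasDiscExpansion.one.add .X).add hfr).congr fun q hq ↦ ?_⟩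
  · rw [map_add]; exact add_pos_of_pos_of_nonneg (by simp) (hr 0)
  · rw [map_add]; exact add_pos_of_pos_of_nonneg (by simp [PowerSeries.coeff_one]) (hr 1)
  · have hp := hp hq
    have h1 : Summable fun n : ℕ ↦ q ^ ((n + 1) ^ 2) :=
      (summable_nat_add_iff (f := fun n : ℕ ↦ q ^ (n ^ 2)) 1).2 hp
    have hneg (n : ℕ) : ((-((n : ℤ) + 1)).natAbs) = n + 1 := by omega
    rw [oddProd_sq_mul_eulerProd_sq hq, tsum_of_nat_of_neg_add_one (by simpa using hp)
      (by simpa only [hneg] using h1)]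
    simp only [hneg, Int.natAbs_natCast]
    rw [hp.tsum_eq_zero_add, h1.tsum_eq_zero_add]
    simp
    ring_nf

lemma rescale_X_mul_derivative (a : ℂ⟦X⟧) :
    rescale (-1) (X * derivative ℂ a) = X * derivative ℂ (rescale (-1) a) := by
  ext n
  rw [coeff_rescale]
  cases n with
  | zero => simp
  | succ n =>
    rw [coeff_succ_X_mul, coeff_succ_X_mul, coeff_derivative, coeff_derivative, coeff_rescale]
    ring

/-- At `-q` the series `a` becomes the eighth power of `∑ q^(n²)`, so `X a'` turns into a series
with nonnegative coefficients and a positive one at `q`. It is paired with the positive coefficient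
of `qᵏ` in the other factor. -/
lemma coeff_derivative_etaQuotA_mul_ne_zero {k : ℕ} {a r : ℂ⟦X⟧} (ha : HasDiscExpansion etaQuotA a)
    (hr : HasDiscExpansion (fun q ↦ (etaQuotB q)⁻¹ ^ (k + 1)) r) :
    coeff (k + 1) (r * (X * derivative ℂ a)) ≠ 0 := by
  obtain ⟨s, hs, hs0, hs1, hfs⟩ := exists_expansion_oddProd_sq_mul
  obtain ⟨t, ht, ht', hft⟩ := exists_expansion_oddProd_pow_mul (8 * (k + 1)) (8 * (k + 1))
  have h1 := ha.comp_neg.unique ((hfs.pow 8).congr fun q hq ↦ etaQuotA_neg hq)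
  have h2 := hr.comp_neg.unique (hft.congr fun q hq ↦ by
    rw [etaQuotB_neg_inv hq, mul_pow, ← pow_mul, ← pow_mul])
  intro h0
  have h3 : coeff (k + 1) (rescale (-1) (r * (X * derivative ℂ a))) = 0 := by
    rw [coeff_rescale, h0, mul_zero]
  rw [map_mul, rescale_X_mul_derivative, h1, h2] at h3
  have hs8 := coeff_pow_pos hs hs0 hs1 (N := 8) (j := 1) (by norm_num)
  have hD (n : ℕ) : 0 ≤ coeff n (X * derivative ℂ (s ^ 8)) := by
    cases n with
    | zero => simp
    | succ n =>
      rw [coeff_succ_X_mul, coeff_derivative]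
      exact mul_nonneg (hs8.1 _) (by positivity)
  have h4 := coeff_mul_coeff_le ht hD k 1
  rw [h3] at h4
  refine (lt_of_lt_of_le (mul_pos (ht' k (by omega)) ?_) h4).false
  rw [show (1 : ℕ) = 0 + 1 from rfl, coeff_succ_X_mul, coeff_derivative]
  simpa using hs8.2

end SquareSeries

/-! ### Poisson summation in several variables. -/

section PoissonSummation

open Complex Filter Topology MeasureTheory

lemma summable_pi_prod {f : ℤ → ℝ} (hf : Summable f) (h0 : ∀ n, 0 ≤ f n) (v : ℕ) :
    Summable fun x : Fin v → ℤ ↦ ∏ i, f (x i) := by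
  induction v with
  | zero => exact .of_finite
  | succ v ih =>
    rw [← (Fin.consEquiv fun _ : Fin (v + 1) ↦ ℤ).summable_iff]
    have := hf.mul_of_nonneg ih h0 fun x ↦ Finset.prod_nonneg fun i _ ↦ h0 _
    refine this.congr fun x ↦ ?_
    simp [Fin.consEquiv, Fin.prod_univ_succ]

lemma summable_exp_neg_mul_sq {c : ℝ} (hc : 0 < c) :
    Summable fun n : ℤ ↦ Real.exp (-c * (n : ℝ) ^ 2) := by
  have h : Summable fun n : ℕ ↦ Real.exp (-c * (n : ℝ) ^ 2) := by
    refine (Real.summable_exp_nat_mul_iff.2 (neg_lt_zero.2 hc)).of_nonneg_of_le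
      (fun _ ↦ (Real.exp_pos _).le) fun n ↦ Real.exp_le_exp.2 ?_
    have : (n : ℝ) ≤ (n : ℝ) ^ 2 := by exact_mod_cast Nat.le_self_pow two_ne_zero n
    nlinarith
  exact .of_nat_of_neg (by simpa using h) (by simpa using h)

lemma summable_exp_neg_mul_sum_sq {c : ℝ} (hc : 0 < c) (v : ℕ) :
    Summable fun x : Fin v → ℤ ↦ Real.exp (-c * ∑ i, (x i : ℝ) ^ 2) := by
  refine (summable_pi_prod (summable_exp_neg_mul_sq hc) (fun _ ↦ (Real.exp_pos _).le) v).congr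
    fun x ↦ ?_
  rw [← Real.exp_sum, Finset.mul_sum]

/-- Integration over `ℝᵛ` as a sum of integrals over the translates of the unit cube. -/
lemma integral_eq_tsum_integral_cube {v : ℕ} {f : (Fin v → ℝ) → ℂ} (hf : Integrable f) :
    ∫ x, f x = ∑' n : Fin v → ℤ,
      ∫ x in {x : Fin v → ℝ | ∀ i, x i ∈ Set.Ioc (0 : ℝ) (0 + 1)}, f (x + fun i ↦ (n i : ℝ)) := by
  let S : (Fin v → ℤ) → Set (Fin v → ℝ) := fun n ↦ {x | ∀ i, x i ∈ Set.Ioc (n i : ℝ) (n i + 1)}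
  have hmeas (n : Fin v → ℤ) : MeasurableSet (S n) :=
    MeasurableSet.univ_pi' fun i ↦ measurableSet_Ioc
  have hdisj : Pairwise (Function.onFun Disjoint S) := by
    intro m n hmn
    refine Set.disjoint_left.2 fun x hx hy ↦ hmn (funext fun i ↦ ?_)
    have h1 := hx i
    have h2 := hy i
    have h3 : (m i : ℝ) < n i + 1 := h1.1.trans_le h2.2
    have h4 : (n i : ℝ) < m i + 1 := h2.1.trans_le h1.2
    have h3' : m i < n i + 1 := by exact_mod_cast h3
    have h4' : n i < m i + 1 := by exact_mod_cast h4
    omega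
  have hun : ⋃ n, S n = Set.univ := by
    refine Set.eq_univ_of_forall fun x ↦ Set.mem_iUnion.2 ⟨fun i ↦ ⌈x i⌉ - 1, fun i ↦ ?_⟩
    push_cast
    exact ⟨by linarith [Int.ceil_lt_add_one (x i)], by linarith [Int.le_ceil (x i)]⟩
  rw [← setIntegral_univ, ← hun, integral_iUnion hmeas hdisj hf.integrableOn]
  refine tsum_congr fun n ↦ ?_
  rw [← (measurePreserving_add_right volume (fun i ↦ (n i : ℝ))).setIntegral_preimage_emb
    (measurableEmbedding_addRight _)]
  congr 2
  ext x
  simp only [S, Set.mem_preimage, Set.mem_ofPred_eq, Pi.add_apply, Set.mem_Ioc]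
  refine forall_congr' fun i ↦ ⟨fun h ↦ ⟨?_, ?_⟩, fun h ↦ ⟨?_, ?_⟩⟩ <;> linarith [h.1, h.2]

/-- The Poisson summation formula on `ℝᵛ` for continuous functions of Gaussian decay. -/
theorem tsum_eq_tsum_integral_of_gaussian_bound {v : ℕ} {g : (Fin v → ℝ) → ℂ} (hg : Continuous g)
    {c : ℝ} (hc : 0 < c) (hb : ∀ x, ‖g x‖ ≤ Real.exp (-c * ∑ i, x i ^ 2))
    (hs : Summable fun n : Fin v → ℤ ↦
      ∫ x : Fin v → ℝ, cexp (-2 * Real.pi * I * ∑ i, (n i : ℂ) * x i) * g x) :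
    ∑' n : Fin v → ℤ, g (fun i ↦ (n i : ℝ)) =
      ∑' n : Fin v → ℤ, ∫ x : Fin v → ℝ, cexp (-2 * Real.pi * I * ∑ i, (n i : ℂ) * x i) * g x := by
  let sh : (Fin v → ℤ) → (Fin v → ℝ) := fun n i ↦ (n i : ℝ)
  have hbound (R : ℝ) : ∃ u : (Fin v → ℤ) → ℝ, Summable u ∧
      ∀ n x, (∀ i, |x i| ≤ R) → ‖g (x + sh n)‖ ≤ u n := by
    refine ⟨fun n ↦ Real.exp (-(c / 2) * ∑ i, (n i : ℝ) ^ 2) * Real.exp (c * (v * R ^ 2)),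
      (summable_exp_neg_mul_sum_sq (half_pos hc) v).mul_right _, fun n x hx ↦ (hb _).trans ?_⟩
    simp only
    rw [← Real.exp_add, Real.exp_le_exp]
    -- From `n² ≤ 2(x + n)² + 2x²`; this is where the rate `c / 2` comes from.
    have h : ∑ i, (n i : ℝ) ^ 2 ≤ ∑ i, (2 * (x + sh n) i ^ 2 + 2 * R ^ 2) := by
      refine Finset.sum_le_sum fun i _ ↦ ?_
      have h1 : x i ^ 2 ≤ R ^ 2 := sq_le_sq' (abs_le.1 (hx i)).1 (abs_le.1 (hx i)).2
      simp only [Pi.add_apply, sh]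
      nlinarith [sq_nonneg (2 * x i + n i)]
    rw [Finset.sum_add_distrib, ← Finset.mul_sum, Finset.sum_const, Finset.card_univ,
      Fintype.card_fin, nsmul_eq_mul] at h
    nlinarith
  have hper : Continuous fun x ↦ ∑' n, g (x + sh n) := by
    rw [continuous_iff_continuousAt]
    intro x
    obtain ⟨u, hu, hgu⟩ := hbound (‖x‖ + 1)
    refine (continuousOn_tsum (s := Metric.ball 0 (‖x‖ + 1)) (fun n ↦ by fun_prop) hu
      fun n y hy ↦ hgu n y fun i ↦ ?_).continuousAt (Metric.isOpen_ball.mem_nhds (by simp))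
    exact (norm_le_pi_norm y i).trans (mem_ball_zero_iff.1 hy).le
  let proj : C(Fin v → ℝ, UnitAddTorus (Fin v)) :=
    ⟨fun x i ↦ (x i : UnitAddCircle), by fun_prop⟩
  have hproj : IsQuotientMap proj :=
    (IsOpenQuotientMap.piMap fun _ : Fin v ↦
      QuotientAddGroup.isOpenQuotientMap_mk (N := AddSubgroup.zmultiples (1 : ℝ))).isQuotientMap
  have hfac : Function.FactorsThrough (fun x ↦ ∑' n, g (x + sh n)) proj := by
    intro x y hxy
    have h (i : Fin v) : ∃ k : ℤ, (k : ℝ) = y i - x i := by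
      have := QuotientAddGroup.eq.1 (congrFun hxy i)
      obtain ⟨k, hk⟩ := AddSubgroup.mem_zmultiples_iff.1 this
      exact ⟨k, by simp at hk; linarith⟩
    choose k hk using h
    have hy : y = x + sh k := by ext i; simp [sh, hk]
    simp only
    rw [← (Equiv.addRight k).tsum_eq, hy]
    refine tsum_congr fun n ↦ congrArg g ?_
    ext i
    simp [sh]; ring
  let G : C(UnitAddTorus (Fin v), ℂ) := hproj.lift ⟨_, hper⟩ hfac
  have hG (x : Fin v → ℝ) : G (fun i ↦ (x i : UnitAddCircle)) = ∑' n, g (x + sh n) :=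
    DFunLike.congr_fun (hproj.lift_comp ⟨_, hper⟩ hfac) x
  have hF (n : Fin v → ℤ) (x : Fin v → ℝ) :
      UnitAddTorus.mFourier (-n) (fun i ↦ (x i : UnitAddCircle)) =
        cexp (-2 * Real.pi * I * ∑ i, (n i : ℂ) * x i) := by
    simp only [UnitAddTorus.mFourier, ContinuousMap.coe_mk, fourier_coe_apply, Finset.mul_sum,
      Complex.exp_sum]
    refine Finset.prod_congr rfl fun i _ ↦ ?_
    congr 1
    push_cast [Pi.neg_apply]
    ring
  have hnorm (n : Fin v → ℤ) (x : Fin v → ℝ) :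
      ‖cexp (-2 * Real.pi * I * ∑ i, (n i : ℂ) * x i)‖ = 1 := by
    have : -2 * Real.pi * I * ∑ i, (n i : ℂ) * x i =
        ((-2 * Real.pi * ∑ i, (n i : ℝ) * x i : ℝ) : ℂ) * I := by push_cast; ring
    rw [this, Complex.norm_exp_ofReal_mul_I]
  have hintegrable (n : Fin v → ℤ) : Integrable fun x : Fin v → ℝ ↦
      cexp (-2 * Real.pi * I * ∑ i, (n i : ℂ) * x i) * g x := by
    have hgauss : Integrable fun x : Fin v → ℝ ↦ Real.exp (-c * ∑ i, x i ^ 2) := by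
      have := GaussianFourier.integrable_cexp_neg_mul_sum_add (ι := Fin v) (b := c)
        (by simpa using hc) 0
      refine this.norm.congr (.of_forall fun x ↦ ?_)
      have e : -(c : ℂ) * ∑ i, (x i : ℂ) ^ 2 + ∑ i, (0 : Fin v → ℂ) i * x i =
          ((-c * ∑ i, x i ^ 2 : ℝ) : ℂ) := by push_cast; simp
      simp only [e, Complex.norm_exp, ofReal_re]
    refine hgauss.mono' (by fun_prop) (.of_forall fun x ↦ ?_)
    rw [norm_mul, hnorm, one_mul]
    exact hb x
  -- Unfolding: the character is invariant under integer translations, so the cube integral of the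
  -- periodization is the integral over the whole space.
  have hcoeff (n : Fin v → ℤ) : UnitAddTorus.mFourierCoeff G n =
      ∫ x : Fin v → ℝ, cexp (-2 * Real.pi * I * ∑ i, (n i : ℂ) * x i) * g x := by
    rw [UnitAddTorus.mFourierCoeff_eq_integral G n 0, integral_eq_tsum_integral_cube (hintegrable n)]
    simp only [hF, hG, smul_eq_mul, ← tsum_mul_left, Pi.zero_apply]
    obtain ⟨u, hu, hgu⟩ := hbound 1
    have hfin : volume {x : Fin v → ℝ | ∀ i, x i ∈ Set.Ioc (0 : ℝ) (0 + 1)} = 1 := by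
      rw [show {x : Fin v → ℝ | ∀ i, x i ∈ Set.Ioc (0 : ℝ) (0 + 1)} =
        Set.univ.pi fun _ ↦ Set.Ioc (0 : ℝ) (0 + 1) by ext; simp, Real.volume_pi_Ioc]
      simp
    have hexp (m : Fin v → ℤ) (x : Fin v → ℝ) :
        cexp (-2 * Real.pi * I * ∑ i, (n i : ℂ) * ((x + sh m) i : ℝ)) =
        cexp (-2 * Real.pi * I * ∑ i, (n i : ℂ) * x i) := by
      rw [Complex.exp_eq_exp_iff_exists_int]
      refine ⟨-∑ i, n i * m i, ?_⟩
      simp only [sh, Pi.add_apply, ofReal_add, mul_add, Finset.sum_add_distrib]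
      push_cast
      ring
    have hle (m : Fin v → ℤ) : ∀ᵐ x ∂(volume.restrict
        {x : Fin v → ℝ | ∀ i, x i ∈ Set.Ioc (0 : ℝ) (0 + 1)}),
        ‖cexp (-2 * Real.pi * I * ∑ i, (n i : ℂ) * x i) * g (x + sh m)‖ ≤ u m := by
      refine (ae_restrict_iff' (MeasurableSet.univ_pi' fun i ↦ measurableSet_Ioc)).2
        (.of_forall fun x hx ↦ ?_)
      rw [norm_mul, hnorm, one_mul]
      refine hgu m x fun i ↦ ?_
      have := hx i
      rw [zero_add] at this
      rw [abs_of_pos this.1]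
      exact this.2
    have hconst (r : ℝ) : IntegrableOn (fun _ : Fin v → ℝ ↦ r)
        {x : Fin v → ℝ | ∀ i, x i ∈ Set.Ioc (0 : ℝ) (0 + 1)} :=
      integrableOn_const (by rw [hfin]; exact ENNReal.one_ne_top)
    have h := hasSum_integral_of_dominated_convergence
      (μ := volume.restrict {x : Fin v → ℝ | ∀ i, x i ∈ Set.Ioc (0 : ℝ) (0 + 1)})
      (F := fun m x ↦ cexp (-2 * Real.pi * I * ∑ i, (n i : ℂ) * x i) * g (x + sh m))
      (f := fun x ↦ ∑' m, cexp (-2 * Real.pi * I * ∑ i, (n i : ℂ) * x i) * g (x + sh m))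
      (fun m _ ↦ u m) (fun m ↦ by fun_prop) hle (.of_forall fun _ ↦ hu) (hconst _) (by
        filter_upwards [ae_all_iff.2 hle] with x hx
        exact (hu.of_norm_bounded hx).hasSum)
    rw [← h.tsum_eq]
    refine tsum_congr fun m ↦ ?_
    refine integral_congr_ae (.of_forall fun x ↦ ?_)
    exact congrArg (· * g (x + sh m)) (hexp m x).symm
  have hfinal := UnitAddTorus.hasSum_mFourier_series_apply_of_summable (f := G)
    (by simpa only [funext hcoeff] using hs) (fun i ↦ ((0 : ℝ) : UnitAddCircle))
  have h0 := hG 0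
  simp only [Pi.zero_apply, zero_add] at h0
  rw [h0] at hfinal
  rw [← hfinal.tsum_eq]
  refine tsum_congr fun n ↦ ?_
  rw [hcoeff]
  have h1 := hF (-n) 0
  simp at h1
  simp [h1]

end PoissonSummation

/-! ### Gaussian Fourier transforms and theta inversion. -/

section ThetaInversion

open Complex Filter Topology MeasureTheory Matrix

lemma Matrix.PosDef.exists_transpose_mul_self {v : ℕ} {B : Matrix (Fin v) (Fin v) ℝ}
    (hB : B.PosDef) : ∃ M : Matrix (Fin v) (Fin v) ℝ, IsUnit M.det ∧ B = Mᵀ * M := by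
  open scoped MatrixOrder in
  obtain ⟨M, hM⟩ := CStarAlgebra.nonneg_iff_eq_star_mul_self.mp hB.posSemidef.nonneg
  have hM' : B = Mᵀ * M := by
    rw [hM, star_eq_conjTranspose, conjTranspose_eq_transpose_of_trivial]
  refine ⟨M, ?_, hM'⟩
  have h := hB.det_pos.ne'
  rw [hM', det_mul, det_transpose] at h
  exact isUnit_iff_ne_zero.2 (mul_self_ne_zero.1 h)

lemma dotProduct_transpose_mul_self_mulVec {v : ℕ} (M : Matrix (Fin v) (Fin v) ℝ)
    (x : Fin v → ℝ) : x ⬝ᵥ (Mᵀ * M) *ᵥ x = ∑ i, (M *ᵥ x) i ^ 2 := by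
  rw [← mulVec_mulVec, dotProduct_mulVec, vecMul_transpose, dotProduct]
  simp only [sq]

/-- Write `B = Mᵀ M` and `x = M⁻¹ (M x)`, and apply Cauchy–Schwarz to each coordinate. Using `K + 1`
avoids a separate case `K = 0`. -/
lemma Matrix.PosDef.exists_mul_sum_sq_le {v : ℕ} {B : Matrix (Fin v) (Fin v) ℝ} (hB : B.PosDef) :
    ∃ c : ℝ, 0 < c ∧ ∀ x : Fin v → ℝ, c * ∑ i, x i ^ 2 ≤ x ⬝ᵥ B *ᵥ x := by
  obtain ⟨M, hM, rfl⟩ := hB.exists_transpose_mul_self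
  set K : ℝ := ∑ i, ∑ j, M⁻¹ i j ^ 2
  have hK : 0 ≤ K := by positivity
  refine ⟨(K + 1)⁻¹, by positivity, fun x ↦ ?_⟩
  rw [dotProduct_transpose_mul_self_mulVec, inv_mul_le_iff₀ (by positivity)]
  have hx (i : Fin v) : x i ^ 2 ≤ (∑ j, M⁻¹ i j ^ 2) * ∑ j, (M *ᵥ x) j ^ 2 := by
    have : x = M⁻¹ *ᵥ (M *ᵥ x) := by rw [mulVec_mulVec, nonsing_inv_mul M hM, one_mulVec]
    conv_lhs => rw [this]
    exact Finset.sum_mul_sq_le_sq_mul_sq Finset.univ (fun j ↦ M⁻¹ i j) (M *ᵥ x)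
  calc ∑ i, x i ^ 2 ≤ K * ∑ j, (M *ᵥ x) j ^ 2 := by
        rw [Finset.sum_mul]; exact Finset.sum_le_sum fun i _ ↦ hx i
    _ ≤ (K + 1) * ∑ j, (M *ᵥ x) j ^ 2 := by
        refine mul_le_mul_of_nonneg_right (by linarith) (by positivity)

lemma Matrix.PosDef.summable_exp {v : ℕ} {B : Matrix (Fin v) (Fin v) ℝ} (hB : B.PosDef)
    {t : ℝ} (ht : 0 < t) : Summable fun n : Fin v → ℤ ↦
      Real.exp (-t * ((fun i ↦ (n i : ℝ)) ⬝ᵥ B *ᵥ (fun i ↦ (n i : ℝ)))) := by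
  obtain ⟨c, hc, h⟩ := hB.exists_mul_sum_sq_le
  refine (summable_exp_neg_mul_sum_sq (mul_pos ht hc) v).of_nonneg_of_le
    (fun _ ↦ (Real.exp_pos _).le) fun n ↦ Real.exp_le_exp.2 ?_
  nlinarith [h fun i ↦ (n i : ℝ)]

lemma norm_cexp_pi_I_mul {τ : ℂ} (r : ℝ) :
    ‖cexp (Real.pi * I * τ * r)‖ = Real.exp (-(Real.pi * τ.im) * r) := by
  rw [Complex.norm_exp]
  congr 1
  simp

/-- The Fourier transform of `exp (π i τ ᵗxBx)`. -/
lemma Matrix.PosDef.exists_fourier_gaussian {v : ℕ} {B : Matrix (Fin v) (Fin v) ℝ}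
    (hB : B.PosDef) : ∃ C : ℂ, ∀ τ : ℂ, 0 < τ.im → ∀ n : Fin v → ℝ,
      ∫ x : Fin v → ℝ, cexp (-2 * Real.pi * I * ∑ i, (n i : ℂ) * x i) *
        cexp (Real.pi * I * τ * (x ⬝ᵥ B *ᵥ x : ℝ)) =
      C * (I / τ) ^ (v / 2 : ℂ) * cexp (Real.pi * I * (-1 / τ) * (n ⬝ᵥ B⁻¹ *ᵥ n : ℝ)) := by
  obtain ⟨M, hM, rfl⟩ := hB.exists_transpose_mul_self
  have hdet : M.det ≠ 0 := hM.ne_zero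
  -- The Jacobian of `y = M x`, which reduces the integral to a standard Gaussian. Its value is
  -- immaterial for a vanishing argument, so it stays existential.
  refine ⟨((|M.det⁻¹| : ℝ) : ℂ), fun τ hτ n ↦ ?_⟩
  have hτ0 : τ ≠ 0 := by rintro rfl; simp at hτ
  set w : Fin v → ℝ := n ᵥ* M⁻¹
  have hw : ∑ i, w i ^ 2 = n ⬝ᵥ (Mᵀ * M)⁻¹ *ᵥ n := by
    rw [Matrix.mul_inv_rev, ← mulVec_mulVec, dotProduct_mulVec, ← transpose_nonsing_inv,
      mulVec_transpose, dotProduct]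
    simp only [sq, w]
  have hwx (x : Fin v → ℝ) : ∑ i, n i * x i = ∑ i, w i * (M *ᵥ x) i := by
    change n ⬝ᵥ x = w ⬝ᵥ M *ᵥ x
    rw [dotProduct_mulVec, vecMul_vecMul, nonsing_inv_mul M hM, vecMul_one]
  let F : (Fin v → ℝ) → ℂ := fun y ↦
    cexp (-(-(Real.pi * I * τ)) * ∑ i, (y i : ℂ) ^ 2 + ∑ i, (-2 * Real.pi * I * w i) * y i)
  have hF (x : Fin v → ℝ) : cexp (-2 * Real.pi * I * ∑ i, (n i : ℂ) * x i) *
        cexp (Real.pi * I * τ * (x ⬝ᵥ (Mᵀ * M) *ᵥ x : ℝ)) = F (Matrix.toLin' M x) := by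
    have h : ∑ i, (n i : ℂ) * x i = ∑ i, (w i : ℂ) * (M *ᵥ x) i := by exact_mod_cast hwx x
    rw [← Complex.exp_add, dotProduct_transpose_mul_self_mulVec, h]
    simp only [F, toLin'_apply]
    congr 1
    push_cast
    simp only [Finset.mul_sum, mul_assoc]
    ring_nf
  simp only [hF]
  have hmap := Real.map_matrix_volume_pi_eq_smul_volume_pi hdet
  have hcont : Continuous (Matrix.toLin' M) := LinearMap.continuous_of_finiteDimensional _
  have hFc : Continuous F := by fun_prop
  rw [← integral_map hcont.aemeasurable hFc.aestronglyMeasurable, hmap, integral_smul_measure,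
    ENNReal.toReal_ofReal (abs_nonneg _),
    GaussianFourier.integral_cexp_neg_mul_sum_add (by simpa using mul_pos Real.pi_pos hτ),
    Fintype.card_fin, ← hw, Complex.real_smul]
  have hpi : (Real.pi : ℂ) ≠ 0 := by exact_mod_cast Real.pi_ne_zero
  have e1 : (Real.pi : ℂ) / -(Real.pi * I * τ) = I / τ := by
    rw [div_eq_div_iff (by simp [hpi, hτ0]) hτ0]
    linear_combination (Real.pi * τ) * I_sq
  have e2 : (∑ i, (-2 * Real.pi * I * w i) ^ 2) / (4 * -(Real.pi * I * τ)) =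
      Real.pi * I * (-1 / τ) * ((∑ i, w i ^ 2 : ℝ) : ℂ) := by
    push_cast
    simp only [mul_pow, ← Finset.mul_sum]
    field_simp
    ring
  rw [e1, e2, ← mul_assoc]

/-- The inversion formula for the theta function of a positive definite quadratic form. -/
theorem Matrix.PosDef.exists_theta_inversion {v : ℕ} {B : Matrix (Fin v) (Fin v) ℝ}
    (hB : B.PosDef) : ∃ C : ℂ, ∀ τ : ℂ, 0 < τ.im →
      ∑' n : Fin v → ℤ, cexp (Real.pi * I * τ *
        ((fun i ↦ (n i : ℝ)) ⬝ᵥ B *ᵥ (fun i ↦ (n i : ℝ)) : ℝ)) =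
      C * (I / τ) ^ (v / 2 : ℂ) * ∑' n : Fin v → ℤ, cexp (Real.pi * I * (-1 / τ) *
        ((fun i ↦ (n i : ℝ)) ⬝ᵥ B⁻¹ *ᵥ (fun i ↦ (n i : ℝ)) : ℝ)) := by
  obtain ⟨C, hC⟩ := hB.exists_fourier_gaussian
  refine ⟨C, fun τ hτ ↦ ?_⟩
  have hcoeff (n : Fin v → ℤ) := hC τ hτ fun i ↦ (n i : ℝ)
  simp only [ofReal_intCast] at hcoeff
  obtain ⟨c, hc, hcB⟩ := hB.exists_mul_sum_sq_le
  have hpt : 0 < Real.pi * τ.im := mul_pos Real.pi_pos hτ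
  have h := tsum_eq_tsum_integral_of_gaussian_bound
    (g := fun x : Fin v → ℝ ↦ cexp (Real.pi * I * τ * (x ⬝ᵥ B *ᵥ x : ℝ))) (by fun_prop)
    (mul_pos hpt hc) (fun x ↦ by
      rw [norm_cexp_pi_I_mul, Real.exp_le_exp]
      nlinarith [hcB x]) (by
      simp only [hcoeff]
      refine Summable.mul_left _ (.of_norm ?_)
      simp only [norm_cexp_pi_I_mul]
      exact hB.inv.summable_exp (mul_pos Real.pi_pos (im_neg_one_div_pos hτ)))
  rw [h, ← tsum_mul_left]
  exact tsum_congr hcoeff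

end ThetaInversion

/-! ### Theta series of even forms and their duals. -/

section EvenForms

open Complex Filter Topology Matrix

lemma differentiableOn_tsum_pow {ι : Type*} {w : ι → ℕ}
    (hs : ∀ ρ : ℝ, 0 < ρ → ρ < 1 → Summable fun x ↦ ρ ^ w x) :
    DifferentiableOn ℂ (fun q : ℂ ↦ ∑' x, q ^ w x) (Metric.ball 0 1) := by
  intro q hq
  obtain ⟨ρ, hρ, hρ1⟩ := exists_between (mem_ball_zero_iff.1 hq)
  have h0 : 0 < ρ := (norm_nonneg q).trans_lt hρ
  have h := differentiableOn_tsum_of_summable_norm (F := fun x (q : ℂ) ↦ q ^ w x)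
    (hs ρ h0 hρ1) (U := Metric.ball 0 ρ) (fun x ↦ by fun_prop) Metric.isOpen_ball
    fun x z hz ↦ by
      rw [norm_pow]
      exact pow_le_pow_left₀ (norm_nonneg _) (mem_ball_zero_iff.1 hz).le _
  exact (h.differentiableAt (Metric.isOpen_ball.mem_nhds (by simpa using hρ))).differentiableWithinAt

namespace IsEvenPosDef

variable {v : ℕ} {A : Matrix (Fin v) (Fin v) ℤ}

/-- By symmetry the off-diagonal terms occur in equal pairs, and the diagonal ones are even. -/
lemma even_quadForm (hA : IsEvenPosDef A) (x : Fin v → ℤ) : Even (quadForm A x) := by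
  let U : Matrix (Fin v) (Fin v) ℤ := Matrix.of fun i j ↦ if i < j then A i j else 0
  have hU : A = U + Uᵀ + Matrix.diagonal fun i ↦ A i i := by
    ext i j
    rcases lt_trichotomy i j with h | rfl | h
    · simp [U, h, h.not_gt, h.ne]
    · simp [U]
    · simp [U, h, h.not_gt, h.ne', hA.isSymm.apply]
  have h1 : x ⬝ᵥ Uᵀ *ᵥ x = x ⬝ᵥ U *ᵥ x := by
    rw [mulVec_transpose, dotProduct_comm, ← dotProduct_mulVec]
  rw [quadForm_apply, hU, add_mulVec, add_mulVec, dotProduct_add, dotProduct_add, h1]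
  refine (Even.add_self _).add ?_
  simp only [dotProduct, mulVec_diagonal]
  exact Finset.even_sum _ fun i _ ↦ ((hA.even_diag i).mul_right _).mul_left _

lemma cast_quadForm (A : Matrix (Fin v) (Fin v) ℤ) (x : Fin v → ℤ) :
    (fun i ↦ (x i : ℝ)) ⬝ᵥ A.map (Int.cast : ℤ → ℝ) *ᵥ (fun i ↦ (x i : ℝ)) =
      (quadForm A x : ℝ) := by
  rw [quadForm_apply]
  simp [dotProduct, mulVec]

lemma quadForm_pos (hA : IsEvenPosDef A) {x : Fin v → ℤ} (hx : x ≠ 0) : 0 < quadForm A x := by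
  have hx' : (fun i ↦ (x i : ℝ)) ≠ 0 := fun h ↦ hx (funext fun i ↦
    Int.cast_eq_zero.1 (congrFun h i))
  have h := (posDef_iff_dotProduct_mulVec.1 hA.posDef).2 hx'
  rw [star_trivial, cast_quadForm] at h
  exact_mod_cast h

/-- Half the value of an even quadratic form at an integer vector. -/
def _root_.halfNorm (A : Matrix (Fin v) (Fin v) ℤ) (x : Fin v → ℤ) : ℕ := (quadForm A x / 2).toNat

lemma two_mul_halfNorm (hA : IsEvenPosDef A) (x : Fin v → ℤ) :
    2 * (halfNorm A x : ℤ) = quadForm A x := by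
  obtain ⟨k, hk⟩ := hA.even_quadForm x
  have h0 : 0 ≤ quadForm A x := by
    rcases eq_or_ne x 0 with rfl | hx
    · simp
    · exact (hA.quadForm_pos hx).le
  rw [halfNorm]
  omega

lemma cast_quadForm_eq (hA : IsEvenPosDef A) (x : Fin v → ℤ) :
    (fun i ↦ (x i : ℝ)) ⬝ᵥ A.map (Int.cast : ℤ → ℝ) *ᵥ (fun i ↦ (x i : ℝ)) =
      2 * (halfNorm A x : ℝ) := by
  rw [cast_quadForm, ← hA.two_mul_halfNorm x]
  push_cast
  rfl

lemma summable_pow_halfNorm (hA : IsEvenPosDef A) (ρ : ℝ) (h0 : 0 < ρ) (h1 : ρ < 1) :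
    Summable fun x ↦ ρ ^ halfNorm A x := by
  have hl := Real.log_neg h0 h1
  refine (hA.posDef.summable_exp (t := -Real.log ρ / 2) (by linarith)).congr fun x ↦ ?_
  rw [hA.cast_quadForm_eq, show -(-Real.log ρ / 2) * (2 * (halfNorm A x : ℝ)) =
    halfNorm A x * Real.log ρ by ring, Real.exp_nat_mul, Real.exp_log h0]

/-- The theta series of an even form as a function of the nome. -/
noncomputable def _root_.thetaSeries (A : Matrix (Fin v) (Fin v) ℤ) (q : ℂ) : ℂ :=
  ∑' x : Fin v → ℤ, q ^ halfNorm A x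

lemma differentiableOn_thetaSeries (hA : IsEvenPosDef A) :
    DifferentiableOn ℂ (thetaSeries A) (Metric.ball 0 1) :=
  differentiableOn_tsum_pow hA.summable_pow_halfNorm

/-- If an even form represents none of `2, 4, …, 2 (m - 1)`, then its theta series is
`1 + O(qᵐ)`. -/
lemma exists_thetaSeries_eq (hA : IsEvenPosDef A) {m : ℕ}
    (hm : ∀ x : Fin v → ℤ, x ≠ 0 → m ≤ halfNorm A x) :
    ∃ R : ℂ → ℂ, DifferentiableOn ℂ R (Metric.ball 0 1) ∧
      ∀ q : ℂ, ‖q‖ < 1 → thetaSeries A q = 1 + q ^ m * R q := by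
  have hs (ρ : ℝ) (h0 : 0 < ρ) (h1 : ρ < 1) :
      Summable fun x : {x : Fin v → ℤ // x ≠ 0} ↦ ρ ^ (halfNorm A x - m) := by
    refine (((hA.summable_pow_halfNorm ρ h0 h1).comp_injective Subtype.val_injective).mul_left
      (ρ ^ m)⁻¹).congr fun x ↦ ?_
    rw [Function.comp_apply, inv_mul_eq_iff_eq_mul₀ (by positivity), ← pow_add,
      Nat.add_sub_cancel' (hm x x.2)]
  refine ⟨_, differentiableOn_tsum_pow hs, fun q hq ↦ ?_⟩
  obtain ⟨ρ, hρ, hρ1⟩ := exists_between hq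
  have h0 : 0 < ρ := (norm_nonneg q).trans_lt hρ
  have hsq : Summable fun x ↦ q ^ halfNorm A x :=
    (hA.summable_pow_halfNorm ρ h0 hρ1).of_norm_bounded fun x ↦ by
      rw [norm_pow]; exact pow_le_pow_left₀ (norm_nonneg _) hρ.le _
  have hz : halfNorm A 0 = 0 := by simp [halfNorm]
  have h1 : ∑' x : ({0} : Set (Fin v → ℤ)), q ^ halfNorm A x = 1 := by
    rw [tsum_singleton 0 fun x ↦ q ^ halfNorm A x, hz, pow_zero]
  rw [thetaSeries, ← hsq.tsum_subtype_add_tsum_subtype_compl {0}, h1, ← tsum_mul_left]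
  congr 1
  refine tsum_congr fun x ↦ ?_
  rw [← pow_add, Nat.add_sub_cancel' (hm x x.2)]

lemma thetaSeries_nome (hA : IsEvenPosDef A) (τ : ℂ) :
    thetaSeries A (nome τ) = ∑' x : Fin v → ℤ, cexp (Real.pi * I * τ *
      ((fun i ↦ (x i : ℝ)) ⬝ᵥ A.map (Int.cast : ℤ → ℝ) *ᵥ (fun i ↦ (x i : ℝ)) : ℝ)) := by
  refine tsum_congr fun x ↦ ?_
  rw [hA.cast_quadForm_eq, nome, ← Complex.exp_nat_mul]
  congr 1
  push_cast
  ring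

/-- If `2 A⁻¹` is even integral, it is the matrix of an even positive definite form. -/
lemma exists_dual (hA : IsEvenPosDef A)
    (h : IsEvenIntegral ((2 : ℚ) • (A.map (Int.cast : ℤ → ℚ))⁻¹)) :
    ∃ D : Matrix (Fin v) (Fin v) ℤ, IsEvenPosDef D ∧
      D.map (Int.cast : ℤ → ℝ) = (2 : ℝ) • (A.map (Int.cast : ℤ → ℝ))⁻¹ := by
  choose D hD using h.1
  have hdetR : (A.map (Int.cast : ℤ → ℝ)).det ≠ 0 := hA.posDef.det_pos.ne'
  have hdet : A.det ≠ 0 := by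
    intro h0
    refine hdetR ?_
    have := (Int.castRingHom ℝ).map_det A
    rw [h0] at this
    simpa using this.symm
  have hdetQ : IsUnit (A.map (Int.cast : ℤ → ℚ)).det := by
    have := (Int.castRingHom ℚ).map_det A
    rw [isUnit_iff_ne_zero]
    intro h0
    refine hdet ?_
    rw [RingHom.mapMatrix_apply, Int.coe_castRingHom, h0] at this
    exact Int.cast_eq_zero.1 this
  have hDQ : (Matrix.of D).map (Int.cast : ℤ → ℚ) = (2 : ℚ) • (A.map (Int.cast : ℤ → ℚ))⁻¹ := by
    ext i j
    simp [← hD i j]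
  -- An identity over the integers carries the inverse from `ℚ` to `ℝ`.
  have hDA : Matrix.of D * A = Matrix.diagonal fun _ ↦ (2 : ℤ) := by
    have hQ : ((Matrix.of D * A).map (Int.cast : ℤ → ℚ)) =
        (Matrix.diagonal fun _ ↦ (2 : ℤ)).map (Int.cast : ℤ → ℚ) := by
      have e := Matrix.map_mul (L := Matrix.of D) (M := A) (f := Int.castRingHom ℚ)
      rw [Int.coe_castRingHom] at e
      rw [e, hDQ, smul_mul, nonsing_inv_mul _ hdetQ]
      ext i j
      by_cases hij : i = j <;> simp [hij]
    exact Matrix.map_injective Int.cast_injective hQ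
  have hDR : (Matrix.of D).map (Int.cast : ℤ → ℝ) = (2 : ℝ) • (A.map (Int.cast : ℤ → ℝ))⁻¹ := by
    have e := Matrix.map_mul (L := Matrix.of D) (M := A) (f := Int.castRingHom ℝ)
    rw [hDA, Int.coe_castRingHom] at e
    have e2 : (Matrix.of D).map (Int.cast : ℤ → ℝ) * A.map (Int.cast : ℤ → ℝ) = (2 : ℝ) • 1 := by
      rw [← e]
      ext i j
      by_cases hij : i = j <;> simp [hij]
    have hu : IsUnit (A.map (Int.cast : ℤ → ℝ)).det := isUnit_iff_ne_zero.2 hdetR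
    calc _ = (Matrix.of D).map (Int.cast : ℤ → ℝ) * A.map (Int.cast : ℤ → ℝ) *
          (A.map (Int.cast : ℤ → ℝ))⁻¹ := by rw [Matrix.mul_assoc, mul_nonsing_inv _ hu, mul_one]
      _ = _ := by rw [e2, smul_mul, one_mul]
  have hpos : ((Matrix.of D).map (Int.cast : ℤ → ℝ)).PosDef := by
    rw [hDR]
    exact hA.posDef.inv.smul two_pos
  refine ⟨Matrix.of D, ⟨?_, fun i ↦ ?_, hpos⟩, hDR⟩
  · ext i j
    have := hpos.isHermitian.apply j i
    simp only [map_apply, star_trivial] at this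
    rw [transpose_apply]
    exact_mod_cast this.symm
  · obtain ⟨k, hk⟩ := h.2 i
    rw [hD i i] at hk
    exact ⟨k, by rw [← two_mul]; exact_mod_cast hk⟩

/-- The inversion formula for theta series of even forms in `4j` variables, with `D = 2 A⁻¹`. -/
lemma exists_thetaSeries_inversion (hA : IsEvenPosDef A) {D : Matrix (Fin v) (Fin v) ℤ}
    (hD : IsEvenPosDef D)
    (hAD : D.map (Int.cast : ℤ → ℝ) = (2 : ℝ) • (A.map (Int.cast : ℤ → ℝ))⁻¹)
    {j : ℕ} (hj : v = 4 * j) :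
    ∃ C : ℂ, ∀ τ : ℂ, 0 < τ.im →
      thetaSeries A (nome (-1 / τ)) = C * τ ^ (2 * j) * thetaSeries D (nome (τ / 2)) := by
  obtain ⟨C, hC⟩ := hA.posDef.exists_theta_inversion
  refine ⟨C * (-1) ^ j, fun τ hτ ↦ ?_⟩
  have h0 : τ ≠ 0 := by rintro rfl; simp at hτ
  rw [hA.thetaSeries_nome, hC _ (im_neg_one_div_pos hτ), hD.thetaSeries_nome, hAD]
  -- The exponent `v / 2 = 2j` is an even integer, so no branch of the power enters.
  have e1 : (I / (-1 / τ)) ^ ((v : ℂ) / 2) = (-1) ^ j * τ ^ (2 * j) := by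
    have : (v : ℂ) / 2 = ((2 * j : ℕ) : ℂ) := by rw [hj]; push_cast; ring
    rw [this, cpow_natCast, show I / (-1 / τ) = -I * τ by field_simp, mul_pow, pow_mul, neg_sq,
      I_sq]
  rw [e1, ← mul_assoc C]
  congr 1
  refine tsum_congr fun x : Fin v → ℤ ↦ congrArg cexp ?_
  rw [smul_mulVec, dotProduct_smul, smul_eq_mul]
  push_cast
  field_simp

end IsEvenPosDef

end EvenForms

/-! ### The auxiliary forms of weight `2 - v/2` and the two contradictions. -/

section QuadraticMinima

open Complex Filter Topology PowerSeries

lemma HasDiscExpansion.const_mul {f : ℂ → ℂ} {p : ℂ⟦X⟧} (hf : HasDiscExpansion f p) (c : ℂ) :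
    HasDiscExpansion (fun q ↦ c * f q) (c • p) := fun q hq ↦ by
  simpa [mul_assoc] using (hf q hq).mul_left c

/-- Multiplying by a function `1 + O(qᵐ⁺¹)` does not change the `m`-th coefficient. -/
lemma HasDiscExpansion.exists_mul_of_eq_one_add {θ R f : ℂ → ℂ} {p : ℂ⟦X⟧} {m : ℕ}
    (hR : DifferentiableOn ℂ R (Metric.ball 0 1))
    (hθ : ∀ q : ℂ, ‖q‖ < 1 → θ q = 1 + q ^ (m + 1) * R q) (hf : HasDiscExpansion f p) :
    ∃ r : ℂ⟦X⟧, HasDiscExpansion (fun q ↦ θ q * f q) r ∧ coeff m r = coeff m p := by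
  have hθ' : HasDiscExpansion θ _ :=
    (HasDiscExpansion.one.add ((HasDiscExpansion.X.pow (m + 1)).mul (.of_differentiableOn hR))).congr
      hθ
  refine ⟨_, hθ'.mul hf, ?_⟩
  rw [add_mul, one_mul, map_add, mul_assoc, coeff_X_pow_mul', if_neg (by omega), add_zero]

variable {v k : ℕ} {A : Matrix (Fin v) (Fin v) ℤ}

lemma differentiableOn_etaQuotA_inv :
    DifferentiableOn ℂ (fun q ↦ (etaQuotA q)⁻¹) (Metric.ball 0 1) :=
  differentiableOn_etaQuotA.inv fun _ hq ↦ etaQuotA_ne_zero (by simpa using hq)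

lemma differentiableOn_etaQuotB_inv :
    DifferentiableOn ℂ (fun q ↦ (etaQuotB q)⁻¹) (Metric.ball 0 1) :=
  differentiableOn_etaQuotB.inv fun _ hq ↦ etaQuotB_ne_zero (by simpa using hq)

/-- An even form `A` in `8k + 4` variables for which `2 A⁻¹` is even integral represents one of
`2, 4, …, 2 (k + 1)`. -/
theorem IsEvenPosDef.exists_halfNorm_le_of_eight_mul_add_four (hA : IsEvenPosDef A)
    (h : IsEvenIntegral ((2 : ℚ) • (A.map (Int.cast : ℤ → ℚ))⁻¹)) (hv : v = 8 * k + 4) :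
    ∃ x : Fin v → ℤ, x ≠ 0 ∧ halfNorm A x ≤ k + 1 := by
  by_contra! hmin
  obtain ⟨D, hD, hAD⟩ := hA.exists_dual h
  obtain ⟨C, hC⟩ := hA.exists_thetaSeries_inversion hD hAD (j := 2 * k + 1) (by omega)
  obtain ⟨R, hR, hθ⟩ := hA.exists_thetaSeries_eq (m := k + 1 + 1) hmin
  have hf := HasDiscExpansion.of_differentiableOn
    (differentiableOn_etaQuotA.mul (differentiableOn_etaQuotB_inv.pow (k + 1)))
  obtain ⟨r, hr, hrc⟩ := hf.exists_mul_of_eq_one_add hR hθ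
  -- The weights add up to `(4k + 2) + 4 - 4(k + 1) = 2`. At the cusp `0`, `etaQuotA` yields the
  -- required factor `nome (τ / 2)`, and the powers of `etaQuotB⁻¹` become powers of `etaQuotA⁻¹`,
  -- holomorphic on the disc.
  refine coeff_etaQuotA_div_etaQuotB_ne_zero hf (hrc ▸ coeff_eq_zero_of_inversion hr
    (h := fun q ↦ C * 16 * 256 ^ (k + 1) * (thetaSeries D q * (etaQuotB q *
      (etaQuotA q)⁻¹ ^ (k + 1)))) ?_ (k + 1) fun τ hτ ↦ ?_)
  · exact (hD.differentiableOn_thetaSeries.mul (differentiableOn_etaQuotB.mul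
      (differentiableOn_etaQuotA_inv.pow (k + 1)))).const_mul _
  have h0 : τ ≠ 0 := by rintro rfl; simp at hτ
  have h2 : 0 < (τ / 2).im := by simpa using hτ
  have ha := etaQuotA_ne_zero (norm_nome_lt_one h2)
  have hB : (etaQuotB (nome (-1 / τ)))⁻¹ ^ (k + 1) / nome (-1 / τ) ^ (k + 1) =
      256 ^ (k + 1) / τ ^ (4 * (k + 1)) * (etaQuotA (nome (τ / 2)))⁻¹ ^ (k + 1) := by
    rw [inv_pow, ← one_div, div_div, ← mul_pow, mul_comm (etaQuotB _), etaQuotB_inversion hτ,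
      pow_mul, ← div_pow, ← mul_pow, one_div, ← inv_pow]
    congr 1
    field_simp
  simp only [Pi.mul_apply, Pi.pow_apply]
  rw [hC τ hτ, etaQuotA_inversion hτ, ← mul_assoc, mul_div_assoc, hB]
  field_simp
  ring

/-- The expansion at infinity of `η(τ)²⁴ / η(2τ)²⁴`, up to a factor `q`. -/
noncomputable def etaRatio (q : ℂ) : ℂ := etaQuotA q * (etaQuotB q)⁻¹

/-- The expansion at infinity of `η(2τ)²⁴ / η(τ)²⁴`, up to a factor `q`. -/
noncomputable def etaRatioInv (q : ℂ) : ℂ := etaQuotB q * (etaQuotA q)⁻¹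

lemma differentiableOn_etaRatio_pow (m : ℕ) :
    DifferentiableOn ℂ (fun q ↦ etaRatio q ^ m) (Metric.ball 0 1) :=
  (differentiableOn_etaQuotA.fun_mul differentiableOn_etaQuotB_inv).fun_pow m

lemma differentiableOn_etaRatioInv_pow (m : ℕ) :
    DifferentiableOn ℂ (fun q ↦ etaRatioInv q ^ m) (Metric.ball 0 1) :=
  (differentiableOn_etaQuotB.fun_mul differentiableOn_etaQuotA_inv).fun_pow m

/-- The factors `τ⁴` of the two inversion formulas cancel: weight 0, so that the derivative has
weight 2. The constant is `16 · 256`. -/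
lemma etaRatio_inversion {τ : ℂ} (hτ : 0 < τ.im) :
    etaRatio (nome (-1 / τ)) / nome (-1 / τ) =
      4096 * (nome (τ / 2) * etaRatioInv (nome (τ / 2))) := by
  have h0 : τ ≠ 0 := by rintro rfl; simp at hτ
  have h2 : 0 < (τ / 2).im := by simpa using hτ
  have ha := etaQuotA_ne_zero (norm_nome_lt_one h2)
  rw [etaRatio, etaRatioInv, ← div_eq_mul_inv, div_div, mul_comm (etaQuotB (nome (-1 / τ))),
    etaQuotB_inversion hτ, etaQuotA_inversion hτ]
  field_simp
  ring

lemma hasDerivAt_comp_nome {f : ℂ → ℂ} (hf : DifferentiableOn ℂ f (Metric.ball 0 1)) {z : ℂ}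
    (hz : 0 < z.im) :
    HasDerivAt (fun z ↦ f (nome z)) (2 * Real.pi * I * (nome z * deriv f (nome z))) z := by
  have h := ((hf.differentiableAt (Metric.isOpen_ball.mem_nhds
    (by simpa using norm_nome_lt_one hz))).hasDerivAt).comp z (hasDerivAt_nome z)
  convert! h using 1
  ring

/-- The derivative of the inversion formula for powers of `η(τ)²⁴ / η(2τ)²⁴`. -/
lemma deriv_etaRatio_pow_inversion {τ : ℂ} (hτ : 0 < τ.im) (m : ℕ) :
    (nome (-1 / τ) * deriv (fun q ↦ etaRatio q ^ m) (nome (-1 / τ)) +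
      -(m : ℂ) * etaRatio (nome (-1 / τ)) ^ m) / nome (-1 / τ) ^ m / τ ^ 2 =
    4096 ^ m / 2 * (nome (τ / 2) ^ m * (m * etaRatioInv (nome (τ / 2)) ^ m +
      nome (τ / 2) * deriv (fun q ↦ etaRatioInv q ^ m) (nome (τ / 2)))) := by
  have h0 : τ ≠ 0 := by rintro rfl; simp at hτ
  have h2 : 0 < (τ / 2).im := by simpa using hτ
  have hpow (z : ℂ) : HasDerivAt (fun z ↦ nome z ^ m) (2 * Real.pi * I * (m * nome z ^ m)) z := by
    have h : (fun z ↦ nome z ^ m) = fun z ↦ nome (m * z) := by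
      ext z
      rw [nome, nome, ← Complex.exp_nat_mul]
      congr 1
      ring
    have h' := congrFun h z
    have h1 := (hasDerivAt_nome (m * z)).comp z ((hasDerivAt_id z).const_mul (m : ℂ))
    rw [h]
    convert! h1 using 1
    rw [h']
    ring
  have hs : HasDerivAt (fun z ↦ etaRatio (nome (-1 / z)) ^ m / nome (-1 / z) ^ m)
      (2 * Real.pi * I * ((nome (-1 / τ) * deriv (fun q ↦ etaRatio q ^ m) (nome (-1 / τ)) -
        m * etaRatio (nome (-1 / τ)) ^ m) / nome (-1 / τ) ^ m) / τ ^ 2) τ := by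
    have h1 : HasDerivAt (fun τ : ℂ ↦ -1 / τ) (1 / τ ^ 2) τ := by
      convert! (hasDerivAt_inv h0).const_mul (-1) using 1
      ring
    have h3 := ((hasDerivAt_comp_nome (differentiableOn_etaRatio_pow m)
      (im_neg_one_div_pos hτ)).div (hpow (-1 / τ)) (pow_ne_zero _ (nome_ne_zero _))).comp τ h1
    convert! h3 using 1
    have := nome_ne_zero (-1 / τ)
    field_simp
  have ht : HasDerivAt (fun z ↦ 4096 ^ m * (nome (z / 2) ^ m * etaRatioInv (nome (z / 2)) ^ m))
      (4096 ^ m * (Real.pi * I * nome (τ / 2) ^ m * (m * etaRatioInv (nome (τ / 2)) ^ m +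
        nome (τ / 2) * deriv (fun q ↦ etaRatioInv q ^ m) (nome (τ / 2))))) τ := by
    have h1 : HasDerivAt (fun τ : ℂ ↦ τ / 2) (1 / 2) τ := (hasDerivAt_id τ).div_const 2
    have h3 := (((hpow (τ / 2)).mul (hasDerivAt_comp_nome
      (differentiableOn_etaRatioInv_pow m) h2)).comp τ h1).const_mul (4096 ^ m)
    convert! h3 using 1
    ring
  have hst : (fun z ↦ etaRatio (nome (-1 / z)) ^ m / nome (-1 / z) ^ m) =ᶠ[𝓝 τ]
      fun z ↦ 4096 ^ m * (nome (z / 2) ^ m * etaRatioInv (nome (z / 2)) ^ m) := by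
    filter_upwards [(isOpen_lt continuous_const Complex.continuous_im).mem_nhds hτ] with z hz
    rw [← div_pow, ← mul_pow, ← mul_pow, etaRatio_inversion hz]
  have hE := (hs.congr_of_eventuallyEq hst.symm).unique ht
  have hpI : (2 * Real.pi * I : ℂ) ≠ 0 := two_pi_I_ne_zero
  refine mul_left_cancel₀ hpI ?_
  linear_combination hE

/-- The coefficient of `qᵏ⁺¹` in the expansion at infinity of the meromorphic form of weight
`2 - 4k` used for forms in `8k` variables does not vanish. -/
lemma exists_expansion_coeff_ne_zero (hk : k ≠ 0) : ∃ p : ℂ⟦X⟧, coeff (k + 1) p ≠ 0 ∧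
    HasDiscExpansion (fun q ↦ (etaQuotA q)⁻¹ ^ k *
      (q * deriv (fun q ↦ etaRatio q ^ (k + 1)) q + -((k + 1 : ℕ) : ℂ) * etaRatio q ^ (k + 1)))
      p := by
  obtain ⟨pα, hα⟩ : ∃ p, HasDiscExpansion (fun q ↦ (etaQuotA q)⁻¹ ^ k) p :=
    ⟨_, .of_differentiableOn (differentiableOn_etaQuotA_inv.fun_pow k)⟩
  obtain ⟨pσ, hσ⟩ : ∃ p, HasDiscExpansion (fun q ↦ etaRatio q ^ (k + 1)) p :=
    ⟨_, .of_differentiableOn (differentiableOn_etaRatio_pow (k + 1))⟩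
  obtain ⟨pA, hA⟩ : ∃ p, HasDiscExpansion etaQuotA p :=
    ⟨_, .of_differentiableOn differentiableOn_etaQuotA⟩
  obtain ⟨pB, hB⟩ : ∃ p, HasDiscExpansion (fun q ↦ (etaQuotB q)⁻¹ ^ (k + 1)) p :=
    ⟨_, .of_differentiableOn (differentiableOn_etaQuotB_inv.fun_pow (k + 1))⟩
  -- With `α = a⁻ᵏ` one has `α' = -k a^(-k-1) a'`, whose power of `a` cancels the one in `σ`. This
  -- is the product left after integration by parts.
  have hD : pσ * (X * derivative ℂ pα) = (-(k : ℂ)) • (pB * (X * derivative ℂ pA)) := by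
    refine (hσ.mul hα.mul_deriv).unique
      (((hB.mul hA.mul_deriv).const_mul (-(k : ℂ))).congr fun q hq ↦ ?_)
    have ha := etaQuotA_ne_zero hq
    have hd := (((differentiableOn_etaQuotA.differentiableAt (Metric.isOpen_ball.mem_nhds
      (by simpa using hq))).hasDerivAt.fun_inv ha).fun_pow k).deriv
    obtain ⟨l, rfl⟩ := Nat.exists_eq_succ_of_ne_zero hk
    rw [hd, etaRatio]
    simp only [Nat.succ_eq_add_one, Nat.add_sub_cancel, inv_pow, mul_pow]
    field_simp
    ring
  refine ⟨_, ?_, hα.mul (hσ.mul_deriv.add (hσ.const_mul _))⟩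
  have e : X * derivative ℂ pσ + (-((k + 1 : ℕ) : ℂ)) • pσ =
      X * derivative ℂ pσ - ((k + 1 : ℕ) : ℂ⟦X⟧) * pσ := by
    rw [neg_smul, sub_eq_add_neg, ← nsmul_eq_mul, Nat.cast_smul_eq_nsmul]
  rw [e, coeff_mul_X_mul_derivative_sub, hD, PowerSeries.coeff_smul]
  simpa using ⟨hk, coeff_derivative_etaQuotA_mul_ne_zero hA hB⟩

/-- An even form `A` in `8k > 0` variables for which `2 A⁻¹` is even integral represents one of
`2, 4, …, 2 (k + 1)`. -/
theorem IsEvenPosDef.exists_halfNorm_le_of_eight_mul (hA : IsEvenPosDef A)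
    (h : IsEvenIntegral ((2 : ℚ) • (A.map (Int.cast : ℤ → ℚ))⁻¹)) (hv : v = 8 * k) (hk : k ≠ 0) :
    ∃ x : Fin v → ℤ, x ≠ 0 ∧ halfNorm A x ≤ k + 1 := by
  by_contra! hmin
  obtain ⟨D, hD, hAD⟩ := hA.exists_dual h
  obtain ⟨C, hC⟩ := hA.exists_thetaSeries_inversion hD hAD (j := 2 * k) (by omega)
  obtain ⟨R, hR, hθ⟩ := hA.exists_thetaSeries_eq (m := k + 1 + 1) hmin
  obtain ⟨p, hp, hf⟩ := exists_expansion_coeff_ne_zero hk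
  obtain ⟨r, hr, hrc⟩ := hf.exists_mul_of_eq_one_add hR hθ
  -- At the cusp `0`, `etaQuotA⁻¹ ^ k` acquires a pole of order `k` in `nome (τ / 2)` and the
  -- derivative a zero of order at least `k + 1`, so one factor `nome (τ / 2)` is left.
  refine hp (hrc ▸ coeff_eq_zero_of_inversion hr
    (h := fun q ↦ C * (16 ^ k)⁻¹ * (4096 ^ (k + 1) / 2) * (thetaSeries D q *
      ((etaQuotB q)⁻¹ ^ k * (((k + 1 : ℕ) : ℂ) * etaRatioInv q ^ (k + 1) +
        q * deriv (fun q ↦ etaRatioInv q ^ (k + 1)) q)))) ?_ (k + 1) fun τ hτ ↦ ?_)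
  · have hT := differentiableOn_etaRatioInv_pow (k + 1)
    exact DifferentiableOn.const_mul (hD.differentiableOn_thetaSeries.fun_mul
      ((differentiableOn_etaQuotB_inv.fun_pow k).fun_mul ((hT.const_mul _).fun_add
      (differentiableOn_id.fun_mul (hT.deriv Metric.isOpen_ball))))) _
  have h0 : τ ≠ 0 := by rintro rfl; simp at hτ
  have h2 : 0 < (τ / 2).im := by simpa using hτ
  have hb := etaQuotB_ne_zero (norm_nome_lt_one h2)
  have hn := nome_ne_zero (τ / 2)
  rw [mul_div_assoc, mul_div_assoc, mul_div_assoc, mul_div_assoc,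
    deriv_etaRatio_pow_inversion hτ, hC τ hτ, etaQuotA_inversion hτ, pow_succ (nome (τ / 2))]
  simp only [inv_pow, mul_pow, ← pow_mul]
  field_simp
  ring

end QuadraticMinima

/-! ### Deduction of the two bounds. -/

theorem theorem3p1 (v : ℕ) (A : Matrix (Fin v) (Fin v) ℤ)
    (hA : IsEvenPosDef A) (hlevel : HasLevel A 2) :
    (8 ∣ v → ∃ n : ℕ, 0 < n ∧ (2 * n : ℚ) ≤ 2 + (v : ℚ) / 4 ∧
      Represents (quadForm A) (2 * n)) ∧
    (v ≡ 4 [MOD 8] → ∃ n : ℕ, 0 < n ∧ (2 * n : ℚ) ≤ 1 + (v : ℚ) / 4 ∧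
      Represents (quadForm A) (2 * n)) := by
  have h2 : IsEvenIntegral ((2 : ℚ) • (A.map (Int.cast : ℤ → ℚ))⁻¹) := by
    simpa using hlevel.1.2
  have hpos {x : Fin v → ℤ} (hx : x ≠ 0) : 0 < halfNorm A x := by
    have h1 := hA.two_mul_halfNorm x
    have h3 := hA.quadForm_pos hx
    omega
  refine ⟨fun ⟨k, hk⟩ ↦ ?_, fun hv ↦ ?_⟩
  -- In dimension zero the integrality conditions are vacuous and the level is 1.
  · have hk0 : k ≠ 0 := by
      rintro rfl
      obtain rfl : v = 0 := hk
      have := hlevel.2 (show 1 ∈ {M : ℕ | 0 < M ∧ IsEvenIntegral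
        ((M : ℚ) • (A.map (Int.cast : ℤ → ℚ))⁻¹)} from
        ⟨one_pos, fun i ↦ i.elim0, fun i ↦ i.elim0⟩)
      omega
    obtain ⟨x, hx, hle⟩ := hA.exists_halfNorm_le_of_eight_mul h2 hk hk0
    refine ⟨halfNorm A x, hpos hx, ?_, x, (hA.two_mul_halfNorm x).symm⟩
    have : (halfNorm A x : ℚ) ≤ k + 1 := by exact_mod_cast hle
    have hv' : (v : ℚ) = 8 * k := by exact_mod_cast hk
    rw [hv']
    linarith
  · obtain ⟨k, hk⟩ : ∃ k, v = 8 * k + 4 := ⟨v / 8, by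
      have : v % 8 = 4 := hv
      omega⟩
    obtain ⟨x, hx, hle⟩ := hA.exists_halfNorm_le_of_eight_mul_add_four h2 hk
    refine ⟨halfNorm A x, hpos hx, ?_, x, (hA.two_mul_halfNorm x).symm⟩
    have : (halfNorm A x : ℚ) ≤ k + 1 := by exact_mod_cast hle
    have hv' : (v : ℚ) = 8 * k + 4 := by exact_mod_cast hk
    rw [hv']
    linarith
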